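/- Let $k$ be a field and let $Q$ be a finite ordered quiver: finitely many vertices (the set $Q_0$), finitely many arrows, and no non-trivial oriented cycles. Let $R$ be a set of tensor relations on $Q$ over $k$. That is, $R$ is a set of $k$-linear combinations of parallel non-trivial paths, the unit representation $U$ ($k$ at every vertex, the identity at every arrow) satisfies $R$, and if two finite-dimensional representations of $Q$ satisfy $R$ then so does their vertexwise tensor product. Let $(Q,R)\text{-}\mathrm{Rep}$ be the category of finite-dimensional representations of $Q$ over $k$ that satisfy $R$, and let $D(Q)=D^b((Q,R)\text{-}\mathrm{Rep})$ be its bounded derived category, a $k$-linear tensor triangulated category under the vertexwise tensor product. Let $D^b(k)=D^b(\mathrm{Vect})$ be the bounded derived category of $k$-vector spaces with its usual tensor product. Here $\mathrm{Vect}$ may be the finite-dimensional vector spaces or all vector spaces; more generally, it may be any class of vector spaces that contains $k$ and is closed under quotients, finite direct sums and tensor products (the statement holds for each choice). A $k$-rational point of $D(Q)$ is an isomorphism class (under natural isomorphism) of $k$-linear exact functors $F:D(Q)\to D^b(k)$ that preserve tensor products and the unit object; $D(Q)(k)$ is the set of these points. A prime ideal of $D(Q)$ is a full thick triangulated subcategory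 $P\neq D(Q)$ such that $V\in P$ implies $V\otimes W\in P$ for every $W$, and $V\otimes W\in P$ implies $V\in P$ or $W\in P$; $\mathrm{Spc}\,D(Q)$ is the set of prime ideals. For $n\in Q_0$ let $F_n:D(Q)\to D^b(k)$ be the functor induced by the exact functor $V\mapsto V_n$ that takes the vector space at $n$. Then $F_n$ is the functor $V\mapsto H(V)_n$, in the sense that $H^i(F_n(V))\cong H^i(V)_n$ naturally in $V\in D(Q)$, for all $i\in\mathbb Z$; each $F_n$ is $k$-linear, exact, and preserves tensor products and the unit, so it defines a $k$-rational point; and $$D(Q)(k)=\{F_n \mid n\in Q_0\}.$$ More precisely, $n\mapsto F_n$ is a bijection $Q_0\to D(Q)(k)$. Furthermore, for every $k$-rational point $F$ the kernel $\ker F=\{V : F(V)=0\}$ is a prime ideal, and $F\mapsto\ker F$ is a bijection $D(Q)(k)\to\mathrm{Spc}\,D(Q)$. -/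

import Mathlib

set_option linter.unusedSectionVars false

open CategoryTheory Limits MonoidalCategory Pretriangulated HomotopicalAlgebra

universe u v w

namespace BoundedDerived

section Complexes

variable {A : Type*} [Category* A] [Abelian A] (P : ObjectProperty A)

/-- Bounded cochain complexes all of whose terms satisfy `P`. -/
def bounded : ObjectProperty (CochainComplex A ℤ) := fun K ↦
  (∃ a : ℤ, K.IsStrictlyGE a) ∧ (∃ b : ℤ, K.IsStrictlyLE b) ∧ ∀ i, P (K.X i)

/-- The category `Cᵇ(P)` of bounded complexes with terms in `P`. -/
abbrev Cb := (bounded P).FullSubcategory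

/-- Quasi-isomorphisms in `Cᵇ(P)`. -/
def quasiIso : MorphismProperty (Cb P) :=
  (HomologicalComplex.quasiIso A (ComplexShape.up ℤ)).inverseImage (bounded P).ι

/-- The corresponding property of objects of the homotopy category. -/
def hBounded : ObjectProperty (HomotopyCategory A (.up ℤ)) :=
  (bounded P).strictMap (HomotopyCategory.quotient A (.up ℤ))

lemma hBounded_quotient_iff (K : CochainComplex A ℤ) :
    hBounded P ((HomotopyCategory.quotient _ _).obj K) ↔ bounded P K := by
  refine ⟨?_, fun h ↦ ⟨_, h⟩⟩
  simp only [hBounded, ObjectProperty.strictMap_iff]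
  rintro ⟨L, h, hL⟩
  obtain rfl : L = K := congr_arg Quotient.as hL
  exact h

variable [P.IsClosedUnderQuotients] [P.IsClosedUnderFiniteProducts]

lemma prop_zero (X : A) (hX : IsZero X) : P X :=
  P.prop_of_isTerminal X hX.isTerminal

lemma prop_biprod {X Y : A} (hX : P X) (hY : P Y) : P (X ⊞ Y) :=
  P.prop_of_isLimit_binaryFan (BinaryBiproduct.isLimit X Y) hX hY

lemma bounded_homotopyCofiber {K L : CochainComplex A ℤ} (f : K ⟶ L)
    (hK : bounded P K) (hL : bounded P L) : bounded P (HomologicalComplex.homotopyCofiber f) := by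
  obtain ⟨⟨a, _⟩, ⟨b, _⟩, hP⟩ := hK
  obtain ⟨⟨a', _⟩, ⟨b', _⟩, hP'⟩ := hL
  refine ⟨⟨min (a - 1) a', ?_⟩, ⟨max b b', ?_⟩, fun i ↦ ?_⟩
  · rw [CochainComplex.isStrictlyGE_iff]
    intro i hi
    refine HomologicalComplex.homotopyCofiber.isZero_X f _ (L.isZero_of_isStrictlyGE a' i ?_)
      (fun j hj ↦ K.isZero_of_isStrictlyGE a j ?_)
    · exact lt_of_lt_of_le hi (min_le_right _ _)
    · have := lt_of_lt_of_le hi (min_le_left _ _)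
      simp only [ComplexShape.up_Rel] at hj
      lia
  · rw [CochainComplex.isStrictlyLE_iff]
    intro i hi
    refine HomologicalComplex.homotopyCofiber.isZero_X f _ (L.isZero_of_isStrictlyLE b' i ?_)
      (fun j hj ↦ K.isZero_of_isStrictlyLE b j ?_)
    · exact lt_of_le_of_lt (le_max_right _ _) hi
    · have := lt_of_le_of_lt (le_max_left _ _) hi
      simp only [ComplexShape.up_Rel] at hj
      lia
  · exact P.prop_of_iso (HomologicalComplex.homotopyCofiber.XIsoBiprod f i (i + 1) rfl).symm
      (prop_biprod P (hP _) (hP' _))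

lemma bounded_biprod {K L : CochainComplex A ℤ}
    (hK : bounded P K) (hL : bounded P L) : bounded P (K ⊞ L) := by
  obtain ⟨⟨a, _⟩, ⟨b, _⟩, hP⟩ := hK
  obtain ⟨⟨a', _⟩, ⟨b', _⟩, hP'⟩ := hL
  refine ⟨⟨min a a', ?_⟩, ⟨max b b', ?_⟩, fun i ↦ ?_⟩
  · rw [CochainComplex.isStrictlyGE_iff]
    intro i hi
    refine IsZero.of_iso ?_ ((HomologicalComplex.eval A (.up ℤ) i).mapBiprod _ _)
    rw [biprod_isZero_iff]
    exact ⟨K.isZero_of_isStrictlyGE a i (lt_of_lt_of_le hi (min_le_left _ _)),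
      L.isZero_of_isStrictlyGE a' i (lt_of_lt_of_le hi (min_le_right _ _))⟩
  · rw [CochainComplex.isStrictlyLE_iff]
    intro i hi
    refine IsZero.of_iso ?_ ((HomologicalComplex.eval A (.up ℤ) i).mapBiprod _ _)
    rw [biprod_isZero_iff]
    exact ⟨K.isZero_of_isStrictlyLE b i (lt_of_le_of_lt (le_max_left _ _) hi),
      L.isZero_of_isStrictlyLE b' i (lt_of_le_of_lt (le_max_right _ _) hi)⟩
  · exact P.prop_of_iso ((HomologicalComplex.eval A (.up ℤ) i).mapBiprod K L).symm
      (prop_biprod P (hP _) (hP' _))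

lemma bounded_cylinder {K : CochainComplex A ℤ} (hK : bounded P K) :
    bounded P (HomologicalComplex.cylinder K) :=
  bounded_homotopyCofiber P _ hK (bounded_biprod P hK hK)

instance : (hBounded P).ContainsZero where
  exists_zero :=
    ⟨(HomotopyCategory.quotient _ _).obj (HomologicalComplex.zero),
      Functor.map_isZero _ (HomologicalComplex.isZero_zero), by
      rw [hBounded_quotient_iff]
      have h : ∀ i, IsZero ((HomologicalComplex.zero : CochainComplex A ℤ).X i) :=
        fun i ↦ isZero_zero A
      refine ⟨⟨0, ?_⟩, ⟨0, ?_⟩, fun i ↦ prop_zero P _ (h i)⟩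
      · rw [CochainComplex.isStrictlyGE_iff]
        exact fun i _ ↦ h i
      · rw [CochainComplex.isStrictlyLE_iff]
        exact fun i _ ↦ h i⟩

instance : (hBounded P).IsStableUnderShift ℤ where
  isStableUnderShiftBy n :=
    { le_shift K hK := by
        obtain ⟨K : CochainComplex _ _, rfl⟩ := K.quotient_obj_surjective
        rw [hBounded_quotient_iff] at hK
        obtain ⟨⟨a, _⟩, ⟨b, _⟩, hP⟩ := hK
        rw [ObjectProperty.prop_shift_iff, HomotopyCategory.shift_quotient_obj,
          hBounded_quotient_iff]
        exact ⟨⟨a - n, K.isStrictlyGE_shift a n (a - n) (by lia)⟩,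
          ⟨b - n, K.isStrictlyLE_shift b n (b - n) (by lia)⟩, fun i ↦ hP _⟩ }

instance : (hBounded P).IsTriangulatedClosed₃ where
  ext₃' T hT h₁ h₂ := by
    have h₁' : bounded P T.obj₁.as := by rwa [← hBounded_quotient_iff]
    have h₂' : bounded P T.obj₂.as := by rwa [← hBounded_quotient_iff]
    obtain ⟨f : T.obj₁.as ⟶ T.obj₂.as, hf⟩ :=
      (HomotopyCategory.quotient _ _).map_surjective T.mor₁
    refine ⟨_, ?_, ⟨Triangle.π₃.mapIso (isoTriangleOfIso₁₂ T _ hT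
      (HomotopyCategory.mappingCone_triangleh_distinguished f)
        (Iso.refl _) (Iso.refl _) ?_)⟩⟩
    · exact (hBounded_quotient_iff P _).2 (bounded_homotopyCofiber P f h₁' h₂')
    · exact (Category.comp_id _).trans (hf.symm.trans (Category.id_comp _).symm)

instance : (hBounded P).IsTriangulated where
  toIsTriangulatedClosed₂ := .of_isTriangulatedClosed₃

/-- The homotopy category `Kᵇ(P)`. -/
abbrev Kb := (hBounded P).FullSubcategory

/-- The projection `Cᵇ(P) ⥤ Kᵇ(P)`. -/
def quotient : Cb P ⥤ Kb P :=
  ObjectProperty.lift _ ((bounded P).ι ⋙ HomotopyCategory.quotient A (.up ℤ))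
    (fun K ↦ (hBounded_quotient_iff P _).2 K.property)

/-- The acyclic objects of `Kᵇ(P)`. -/
abbrev acyclic : ObjectProperty (Kb P) :=
  (HomotopyCategory.subcategoryAcyclic A).inverseImage (hBounded P).ι

/-- The bounded derived category `Dᵇ(P)`: the Verdier quotient of `Kᵇ(P)` by the acyclic
complexes. -/
def Db := (acyclic P).trW.Localization

noncomputable instance : Category (Db P) :=
  inferInstanceAs (Category (acyclic P).trW.Localization)
noncomputable instance : Preadditive (Db P) :=
  inferInstanceAs (Preadditive (acyclic P).trW.Localization)
noncomputable instance : HasZeroObject (Db P) :=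
  inferInstanceAs (HasZeroObject (acyclic P).trW.Localization)
noncomputable instance : HasShift (Db P) ℤ :=
  inferInstanceAs (HasShift (acyclic P).trW.Localization ℤ)
instance (n : ℤ) : (shiftFunctor (Db P) n).Additive :=
  inferInstanceAs (shiftFunctor (acyclic P).trW.Localization n).Additive
noncomputable instance : Pretriangulated (Db P) :=
  inferInstanceAs (Pretriangulated (acyclic P).trW.Localization)
noncomputable instance (R : Type*) [Ring R] [CategoryTheory.Linear R A] :
    CategoryTheory.Linear R (Db P) :=
  inferInstanceAs (CategoryTheory.Linear R (acyclic P).trW.Localization)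

/-- The localization functor `Kᵇ(P) ⥤ Dᵇ(P)`. -/
def Qh : Kb P ⥤ Db P := (acyclic P).trW.Q

instance : (Qh P).IsLocalization (acyclic P).trW :=
  inferInstanceAs ((acyclic P).trW.Q.IsLocalization (acyclic P).trW)
noncomputable instance : (Qh P).CommShift ℤ :=
  inferInstanceAs ((acyclic P).trW.Q.CommShift ℤ)
instance : (Qh P).IsTriangulated :=
  inferInstanceAs ((acyclic P).trW.Q.IsTriangulated)
noncomputable instance (R : Type*) [Ring R] [CategoryTheory.Linear R A] :
    (Qh P).Linear R :=
  inferInstanceAs ((acyclic P).trW.Q.Linear R)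

/-- Quasi-isomorphisms in `Kᵇ(P)`. -/
def hQuasiIso : MorphismProperty (Kb P) :=
  (HomotopyCategory.quasiIso A (.up ℤ)).inverseImage (hBounded P).ι

lemma hQuasiIso_eq_trW : hQuasiIso P = (acyclic P).trW := by
  ext K L f
  obtain ⟨M, g, h, mem⟩ := CategoryTheory.Pretriangulated.distinguished_cocone_triangle f
  have := (HomotopyCategory.subcategoryAcyclic A).trW_iff_of_distinguished _
    ((hBounded P).ι.map_distinguished _ mem)
  rw [← HomotopyCategory.quasiIso_eq_trW_subcategoryAcyclic] at this
  exact this.trans ((acyclic P).trW_iff_of_distinguished _ mem).symm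

instance : (Qh P).IsLocalization (hQuasiIso P) := by
  rw [hQuasiIso_eq_trW]
  infer_instance

/-- Homotopy equivalences in `Cᵇ(P)`. -/
def homotopyEquivalences : MorphismProperty (Cb P) :=
  (HomologicalComplex.homotopyEquivalences A (.up ℤ)).inverseImage (bounded P).ι

lemma quotient_obj_surjective : Function.Surjective (quotient P).obj := fun K ↦ by
  obtain ⟨L, hL⟩ := HomotopyCategory.quotient_obj_surjective K.obj
  refine ⟨⟨L, ?_⟩, by ext; exact hL⟩
  rw [← hBounded_quotient_iff, hL]
  exact K.property

instance : (quotient P).EssSurj where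
  mem_essImage K := by
    obtain ⟨L, rfl⟩ := quotient_obj_surjective P K
    exact ⟨L, ⟨Iso.refl _⟩⟩

instance : (quotient P).Full := by dsimp [quotient]; infer_instance

open HomologicalComplex in
instance : (quotient P).IsLocalization (homotopyEquivalences P) :=
  Functor.isLocalization_of_essSurj_of_full_of_exists_cylinders _ _
    (fun _ _ f hf ↦ by
      have : IsIso ((hBounded P).ι.map ((quotient P).map f)) :=
        HomotopyCategory.quotient_inverts_homotopyEquivalences A (.up ℤ) f.hom hf
      exact isIso_of_reflects_iso _ (hBounded P).ι) (by
    rintro K L f₀ f₁ hf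
    obtain ⟨f₀, rfl⟩ := ObjectProperty.homMk_surjective f₀
    obtain ⟨f₁, rfl⟩ := ObjectProperty.homMk_surjective f₁
    replace hf := HomotopyCategory.homotopyOfEq f₀ f₁ ((hBounded P).ι.congr_map hf)
    exact ⟨K.obj.precylinder.toFullSubcategory (bounded_cylinder P K.property),
      Precylinder.LeftHomotopy.fullSubcategoryEquiv.symm
      { h := cylinder.desc _ _ hf
        h₀ := cylinder.ι₀_desc _ _ hf
        h₁ := cylinder.ι₁_desc _ _ hf }, ⟨cylinder.homotopyEquiv _ (fun n ↦ ⟨n - 1, by simp⟩), rfl⟩⟩)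

lemma quotient_map_mem_iff {K L : Cb P} (f : K ⟶ L) :
    hQuasiIso P ((quotient P).map f) ↔ quasiIso P f :=
  HomotopyCategory.quotient_map_mem_quasiIso_iff f.hom

instance : (hQuasiIso P).RespectsIso := by
  dsimp only [hQuasiIso]
  infer_instance

lemma hQuasiIso_eq_map : hQuasiIso P = (quasiIso P).map (quotient P) := by
  ext K L f
  obtain ⟨K, rfl⟩ := quotient_obj_surjective P K
  obtain ⟨L, rfl⟩ := quotient_obj_surjective P L
  obtain ⟨f, rfl⟩ := (quotient P).map_surjective f
  constructor
  · intro hf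
    rw [quotient_map_mem_iff] at hf
    exact MorphismProperty.map_mem_map _ _ _ hf
  · rintro ⟨K', L', g, h, ⟨e⟩⟩
    rw [← quotient_map_mem_iff] at h
    exact ((hQuasiIso P).arrow_mk_iso_iff e).1 h

/-- The localization functor `Cᵇ(P) ⥤ Dᵇ(P)`. -/
noncomputable def Q : Cb P ⥤ Db P := quotient P ⋙ Qh P

instance : (Q P).IsLocalization (quasiIso P) :=
  Functor.IsLocalization.comp (quotient P) (Qh P) (homotopyEquivalences P) (hQuasiIso P)
    (quasiIso P)
    (fun K L f hf ↦ by
      exact Localization.inverts (Qh P) (hQuasiIso P) _ ((quotient_map_mem_iff P f).2 hf))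
    (fun K L f hf ↦ homotopyEquivalences_le_quasiIso A (.up ℤ) f.hom hf)
    (by rw [hQuasiIso_eq_map])

end Complexes

section Monoidal

variable {A : Type*} [Category* A] [Abelian A] [MonoidalCategory A] [MonoidalPreadditive A]
  [HasColimitsOfSize.{0, 0} A]
  [∀ X : A, PreservesColimitsOfSize.{0, 0} ((curriedTensor A).obj X)]
  [∀ X : A, PreservesColimitsOfSize.{0, 0} ((curriedTensor A).flip.obj X)]
  (P : ObjectProperty A) [P.IsClosedUnderQuotients] [P.IsClosedUnderFiniteProducts]

/-- The total tensor product of cochain complexes. -/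
noncomputable instance cochainMonoidal : MonoidalCategory (CochainComplex A ℤ) :=
  HomologicalComplex.monoidalCategory A (ComplexShape.up ℤ)

lemma bounded_unit (h : P (𝟙_ A)) : bounded P (𝟙_ (CochainComplex A ℤ)) := by
  change bounded P ((HomologicalComplex.single A (.up ℤ) 0).obj (𝟙_ A))
  refine ⟨⟨0, ?_⟩, ⟨0, ?_⟩, fun i ↦ ?_⟩
  · rw [CochainComplex.isStrictlyGE_iff]
    exact fun i hi ↦ HomologicalComplex.isZero_single_obj_X _ _ _ _ hi.ne
  · rw [CochainComplex.isStrictlyLE_iff]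
    exact fun i hi ↦ HomologicalComplex.isZero_single_obj_X _ _ _ _ hi.ne'
  · by_cases hi : i = 0
    · exact P.prop_of_iso (HomologicalComplex.singleObjXIsoOfEq (.up ℤ) 0 (𝟙_ A) i hi).symm h
    · exact prop_zero P _ (HomologicalComplex.isZero_single_obj_X _ _ _ _ hi)

lemma isZero_tensor_left {X Y : A} (h : IsZero X) : IsZero (X ⊗ Y) :=
  (tensorRight Y).map_isZero h

lemma isZero_tensor_right {X Y : A} (h : IsZero Y) : IsZero (X ⊗ Y) :=
  (tensorLeft X).map_isZero h

lemma tensor_hom_ext (K L : CochainComplex A ℤ) {n : ℤ} {Y : A} {f g : (K ⊗ L).X n ⟶ Y}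
    (h : ∀ (i j : ℤ) (hij : i + j = n),
      HomologicalComplex.ιTensorObj K L i j n hij ≫ f =
        HomologicalComplex.ιTensorObj K L i j n hij ≫ g) : f = g :=
  HomologicalComplex.mapBifunctor.hom_ext (fun i j hij ↦ h i j hij)

lemma bounded_tensor {K L : CochainComplex A ℤ}
    (hP : ∀ X Y, P X → P Y → P (X ⊗ Y)) (hK : bounded P K) (hL : bounded P L) :
    bounded P (K ⊗ L) := by
  obtain ⟨⟨a, _⟩, ⟨b, _⟩, hK⟩ := hK
  obtain ⟨⟨a', _⟩, ⟨b', _⟩, hL⟩ := hL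
  refine ⟨⟨a + a', ?_⟩, ⟨b + b', ?_⟩, fun n ↦ ?_⟩
  · rw [CochainComplex.isStrictlyGE_iff]
    intro n hn
    rw [IsZero.iff_id_eq_zero]
    refine tensor_hom_ext K L (fun i j hij ↦ IsZero.eq_of_src ?_ _ _)
    by_cases hi : i < a
    · exact isZero_tensor_left (K.isZero_of_isStrictlyGE a i hi)
    · exact isZero_tensor_right (L.isZero_of_isStrictlyGE a' j (by lia))
  · rw [CochainComplex.isStrictlyLE_iff]
    intro n hn
    rw [IsZero.iff_id_eq_zero]
    refine tensor_hom_ext K L (fun i j hij ↦ IsZero.eq_of_src ?_ _ _)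
    by_cases hi : b < i
    · exact isZero_tensor_left (K.isZero_of_isStrictlyLE b i hi)
    · exact isZero_tensor_right (L.isZero_of_isStrictlyLE b' j (by lia))
  · have : HasFiniteBiproducts A := Abelian.hasFiniteBiproducts
    let F : Finset.Icc a b → A := fun i ↦ K.X i ⊗ L.X (n - i)
    let p : (⨁ F) ⟶ (K ⊗ L).X n :=
      biproduct.desc (fun i ↦ HomologicalComplex.ιTensorObj K L i (n - i) n (by lia))
    have : Epi p := ⟨fun f g hfg ↦ tensor_hom_ext K L (fun i j hij ↦ by
      by_cases hi : i ∈ Finset.Icc a b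
      · obtain rfl : j = n - i := by lia
        have := biproduct.ι F ⟨i, hi⟩ ≫= hfg
        simpa [p] using this
      · refine IsZero.eq_of_src (isZero_tensor_left ?_) _ _
        by_cases hi' : i < a
        · exact K.isZero_of_isStrictlyGE a i hi'
        · exact K.isZero_of_isStrictlyLE b i (by rw [Finset.mem_Icc] at hi; lia))⟩
    exact P.prop_of_epi p (P.prop_of_isLimit_fan (biproduct.isLimit F)
      (fun i ↦ hP _ _ (hK _) (hL _)))

variable [P.IsMonoidal]

instance : (bounded P).IsMonoidal where
  prop_unit := bounded_unit P P.prop_unit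
  prop_tensor _ _ hK hL := bounded_tensor P (fun _ _ ↦ ObjectProperty.prop_tensor) hK hL

variable [(quasiIso P).IsMonoidal]

/-- The derived tensor product on `Dᵇ(P)`: the monoidal structure for which the localization
functor `Cᵇ(P) ⥤ Dᵇ(P)` is monoidal. -/
noncomputable instance : MonoidalCategory (Db P) :=
  inferInstanceAs (MonoidalCategory
    (LocalizedMonoidal (Q P) (quasiIso P) (Iso.refl ((Q P).obj (𝟙_ (Cb P))))))

noncomputable instance : (Q P).Monoidal :=
  inferInstanceAs (Localization.Monoidal.toMonoidalCategory (Q P) (quasiIso P)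
    (Iso.refl ((Q P).obj (𝟙_ (Cb P))))).Monoidal

end Monoidal
section Comparison

variable {A : Type*} [Category* A] [Abelian A] [MonoidalCategory A] [MonoidalPreadditive A]
  [HasColimitsOfSize.{0, 0} A]
  [∀ X : A, PreservesColimitsOfSize.{0, 0} ((curriedTensor A).obj X)]
  [∀ X : A, PreservesColimitsOfSize.{0, 0} ((curriedTensor A).flip.obj X)]
  {A' : Type*} [Category* A'] [Abelian A'] [MonoidalCategory A'] [MonoidalPreadditive A']
  [HasColimitsOfSize.{0, 0} A']
  [∀ X : A', PreservesColimitsOfSize.{0, 0} ((curriedTensor A').obj X)]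
  [∀ X : A', PreservesColimitsOfSize.{0, 0} ((curriedTensor A').flip.obj X)]

lemma homotopyEquivalences_whiskerRight {K K' : CochainComplex A ℤ} {f : K ⟶ K'}
    (hf : HomologicalComplex.homotopyEquivalences A (.up ℤ) f) (L : CochainComplex A ℤ) :
    HomologicalComplex.homotopyEquivalences A (.up ℤ) (f ▷ L) := by
  obtain ⟨e, rfl⟩ := hf
  exact ⟨{  hom := e.hom ▷ L
            inv := e.inv ▷ L
            homotopyHomInvId := (Homotopy.ofEq (comp_whiskerRight e.hom e.inv L).symm).trans
              ((HomologicalComplex.mapBifunctorMapHomotopy₁ e.homotopyHomInvId (𝟙 L)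
                (curriedTensor A) (.up ℤ)).trans (Homotopy.ofEq (id_whiskerRight K L)))
            homotopyInvHomId := (Homotopy.ofEq (comp_whiskerRight e.inv e.hom L).symm).trans
              ((HomologicalComplex.mapBifunctorMapHomotopy₁ e.homotopyInvHomId (𝟙 L)
                (curriedTensor A) (.up ℤ)).trans (Homotopy.ofEq (id_whiskerRight K' L))) }, rfl⟩

lemma homotopyEquivalences_whiskerLeft {K K' : CochainComplex A ℤ} {f : K ⟶ K'}
    (hf : HomologicalComplex.homotopyEquivalences A (.up ℤ) f) (L : CochainComplex A ℤ) :
    HomologicalComplex.homotopyEquivalences A (.up ℤ) (L ◁ f) := by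
  obtain ⟨e, rfl⟩ := hf
  exact ⟨{  hom := L ◁ e.hom
            inv := L ◁ e.inv
            homotopyHomInvId := (Homotopy.ofEq (whiskerLeft_comp L e.hom e.inv).symm).trans
              ((HomologicalComplex.mapBifunctorMapHomotopy₂ (𝟙 L) e.homotopyHomInvId
                (curriedTensor A) (.up ℤ)).trans (Homotopy.ofEq (whiskerLeft_id L K)))
            homotopyInvHomId := (Homotopy.ofEq (whiskerLeft_comp L e.inv e.hom).symm).trans
              ((HomologicalComplex.mapBifunctorMapHomotopy₂ (𝟙 L) e.homotopyInvHomId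
                (curriedTensor A) (.up ℤ)).trans (Homotopy.ofEq (whiskerLeft_id L K'))) }, rfl⟩

open HomologicalComplex in
lemma ι_tensor_d (K L : CochainComplex A ℤ) (i j n n' : ℤ) (h : i + j = n) (h' : n + 1 = n') :
    ιTensorObj K L i j n h ≫ (K ⊗ L).d n n' =
      (K.d i (i + 1) ▷ L.X j) ≫ ιTensorObj K L (i + 1) j n' (by lia) +
        i.negOnePow • ((K.X i ◁ L.d j (j + 1)) ≫ ιTensorObj K L i (j + 1) n' (by lia)) := by
  change ιMapBifunctor K L (curriedTensor A) (.up ℤ) i j n h ≫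
    (mapBifunctor K L (curriedTensor A) (.up ℤ)).d n n' = _
  rw [mapBifunctor.d_eq, Preadditive.comp_add, mapBifunctor.ι_D₁, mapBifunctor.ι_D₂,
    mapBifunctor.d₁_eq K L (curriedTensor A) (.up ℤ) (i₁ := i) (i₁' := i + 1) rfl j n'
      (show i + 1 + j = n' by lia),
    mapBifunctor.d₂_eq K L (curriedTensor A) (.up ℤ) i (i₂ := j) (i₂' := j + 1) rfl n'
      (show i + (j + 1) = n' by lia)]
  congr 1
  exact one_smul _ _

open Functor.LaxMonoidal Functor.OplaxMonoidal HomologicalComplex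

lemma ι_whiskerRight {K K' : CochainComplex A ℤ} (f : K ⟶ K')
    (L : CochainComplex A ℤ) (i j n : ℤ) (h : i + j = n) :
    ιTensorObj K L i j n h ≫ (f ▷ L).f n = (f.f i ▷ L.X j) ≫ ιTensorObj K' L i j n h := by
  refine (ι_mapBifunctorMap f (𝟙 L) (curriedTensor A) (.up ℤ) i j n h).trans ?_
  rw [HomologicalComplex.id_f, CategoryTheory.Functor.map_id, Category.id_comp]
  rfl

lemma ι_whiskerLeft {K K' : CochainComplex A ℤ} (f : K ⟶ K')
    (L : CochainComplex A ℤ) (i j n : ℤ) (h : i + j = n) :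
    ιTensorObj L K i j n h ≫ (L ◁ f).f n = (L.X i ◁ f.f j) ≫ ιTensorObj L K' i j n h := by
  refine (ι_mapBifunctorMap (𝟙 L) f (curriedTensor A) (.up ℤ) i j n h).trans ?_
  rw [HomologicalComplex.id_f, CategoryTheory.Functor.map_id, NatTrans.id_app, Category.id_comp]
  rfl

variable (F : A ⥤ A') [F.Monoidal] [F.Additive] [PreservesColimitsOfSize.{0, 0} F]

/-- `F` applied termwise to a cochain complex. -/
noncomputable abbrev mapC : CochainComplex A ℤ ⥤ CochainComplex A' ℤ :=
  F.mapHomologicalComplex (.up ℤ)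

/-- The inclusion of a summand of `F K ⊗ F L`. -/
noncomputable def ιF (K L : CochainComplex A ℤ) (i j n : ℤ) (h : i + j = n) :
    F.obj (K.X i) ⊗ F.obj (L.X j) ⟶ ((mapC F).obj K ⊗ (mapC F).obj L).X n :=
  ιTensorObj ((mapC F).obj K) ((mapC F).obj L) i j n h

/-- The degree `n` part of the comparison map between `F K ⊗ F L` and `F (K ⊗ L)`. -/
noncomputable def tensorComparisonX (K L : CochainComplex A ℤ) (n : ℤ) :
    ((mapC F).obj K ⊗ (mapC F).obj L).X n ⟶ F.obj ((K ⊗ L).X n) :=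
  mapBifunctorDesc (K₁ := (mapC F).obj K)
    (fun i j h ↦ μ F (K.X i) (L.X j) ≫ F.map (ιTensorObj K L i j n h))

lemma ιF_tensorComparisonX (K L : CochainComplex A ℤ) (i j n : ℤ) (h : i + j = n) :
    ιF F K L i j n h ≫ tensorComparisonX F K L n =
      μ F (K.X i) (L.X j) ≫ F.map (ιTensorObj K L i j n h) :=
  ι_mapBifunctorDesc (K₁ := (mapC F).obj K)
      (K₂ := (mapC F).obj L) (F := curriedTensor A') (c := .up ℤ)
      (fun i j h ↦ μ F (K.X i) (L.X j) ≫ F.map (ιTensorObj K L i j n h)) i j h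

lemma ιF_tensorComparisonX_assoc (K L : CochainComplex A ℤ) (i j n : ℤ) (h : i + j = n)
    {Z : A'} (g : F.obj ((K ⊗ L).X n) ⟶ Z) :
    ιF F K L i j n h ≫ tensorComparisonX F K L n ≫ g =
      μ F (K.X i) (L.X j) ≫ F.map (ιTensorObj K L i j n h) ≫ g := by
  rw [← Category.assoc, ιF_tensorComparisonX, Category.assoc]

lemma ιF_hom_ext (K L : CochainComplex A ℤ) {n : ℤ} {Y : A'}
    {f g : ((mapC F).obj K ⊗ (mapC F).obj L).X n ⟶ Y}
    (h : ∀ (i j : ℤ) (hij : i + j = n), ιF F K L i j n hij ≫ f = ιF F K L i j n hij ≫ g) :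
    f = g :=
  tensor_hom_ext _ _ h

lemma ιF_d (K L : CochainComplex A ℤ) (i j n n' : ℤ) (h : i + j = n) (h' : n + 1 = n') :
    ιF F K L i j n h ≫ ((mapC F).obj K ⊗ (mapC F).obj L).d n n' =
      (F.map (K.d i (i + 1)) ▷ F.obj (L.X j)) ≫ ιF F K L (i + 1) j n' (by lia) +
        i.negOnePow • ((F.obj (K.X i) ◁ F.map (L.d j (j + 1))) ≫
          ιF F K L i (j + 1) n' (by lia)) :=
  ι_tensor_d ((mapC F).obj K) ((mapC F).obj L) i j n n' h h'

lemma tensorComparisonX_comm (K L : CochainComplex A ℤ) (n n' : ℤ) (h : n + 1 = n') :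
    tensorComparisonX F K L n ≫ F.map ((K ⊗ L).d n n') =
      ((mapC F).obj K ⊗ (mapC F).obj L).d n n' ≫ tensorComparisonX F K L n' := by
  refine ιF_hom_ext F K L (fun i j hij ↦ ?_)
  rw [ιF_tensorComparisonX_assoc, ← F.map_comp, ι_tensor_d K L i j n n' hij h, F.map_add,
    F.map_comp, Functor.map_units_smul, F.map_comp, Preadditive.comp_add,
    Linear.comp_units_smul, ← Category.assoc (ιF F K L i j n hij), ιF_d F K L i j n n' hij h,
    Preadditive.add_comp, Linear.units_smul_comp, Category.assoc, Category.assoc,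
    ιF_tensorComparisonX, ιF_tensorComparisonX, μ_natural_left_assoc, μ_natural_right_assoc]

instance (K L : CochainComplex A ℤ) (n : ℤ) : IsIso (tensorComparisonX F K L n) := by
  let G := ((((curriedTensor A).mapBifunctorHomologicalComplex
    (.up ℤ) (.up ℤ)).obj K).obj L).toGradedObject
  let p := ComplexShape.π (.up ℤ) (.up ℤ) (.up ℤ)
  have h : IsColimit (Cofan.mk ((K ⊗ L).X n)
      (fun (x : p ⁻¹' {n}) ↦ ιTensorObj K L x.1.1 x.1.2 n x.2)) :=
    G.isColimitCofanMapObj p n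
  have h' := isColimitCofanMkObjOfIsColimit F _ _ h
  let g : F.obj ((K ⊗ L).X n) ⟶ ((mapC F).obj K ⊗ (mapC F).obj L).X n :=
    Cofan.IsColimit.desc h' (fun (x : p ⁻¹' {n}) ↦ δ F (K.X x.1.1) (L.X x.1.2) ≫
      ιF F K L x.1.1 x.1.2 n x.2)
  have hg (i j : ℤ) (hij : i + j = n) : F.map (ιTensorObj K L i j n hij) ≫ g =
      δ F (K.X i) (L.X j) ≫ ιF F K L i j n hij :=
    Cofan.IsColimit.fac h' _ (⟨(i, j), hij⟩ : p ⁻¹' {n})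
  refine ⟨g, ιF_hom_ext F K L (fun i j hij ↦ ?_), Cofan.IsColimit.hom_ext h' _ _ (fun x ↦ ?_)⟩
  · rw [ιF_tensorComparisonX_assoc, hg, Functor.Monoidal.μ_δ_assoc, Category.comp_id]
  · have (i j : ℤ) (hij : i + j = n) :
        F.map (ιTensorObj K L i j n hij) ≫ g ≫ tensorComparisonX F K L n =
          F.map (ιTensorObj K L i j n hij) ≫ 𝟙 _ := by
      rw [← Category.assoc, hg, Category.assoc, ιF_tensorComparisonX,
        Functor.Monoidal.δ_μ_assoc, Category.comp_id]
    exact this _ _ x.2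

/-- The degree `n` part of the comparison isomorphism between `F K ⊗ F L` and `F (K ⊗ L)`. -/
noncomputable def tensorComparisonXIso (K L : CochainComplex A ℤ) (n : ℤ) :
    ((mapC F).obj K ⊗ (mapC F).obj L).X n ≅ F.obj ((K ⊗ L).X n) :=
  asIso (tensorComparisonX F K L n)

/-- For a monoidal functor `F`, the comparison isomorphism between `F K ⊗ F L` and
`F (K ⊗ L)`. -/
noncomputable def tensorComparison (K L : CochainComplex A ℤ) :
    (mapC F).obj K ⊗ (mapC F).obj L ≅ (mapC F).obj (K ⊗ L) :=
  HomologicalComplex.Hom.isoOfComponents (fun n ↦ tensorComparisonXIso F K L n)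
    (fun n n' h ↦ tensorComparisonX_comm F K L n n' h)

lemma ιF_whiskerRight {K K' : CochainComplex A ℤ} (f : K ⟶ K')
    (L : CochainComplex A ℤ) (i j n : ℤ) (h : i + j = n) :
    ιF F K L i j n h ≫ ((mapC F).map f ▷ (mapC F).obj L).f n =
      (F.map (f.f i) ▷ F.obj (L.X j)) ≫ ιF F K' L i j n h :=
  ι_whiskerRight ((mapC F).map f) ((mapC F).obj L) i j n h

lemma ιF_whiskerLeft {K K' : CochainComplex A ℤ} (f : K ⟶ K')
    (L : CochainComplex A ℤ) (i j n : ℤ) (h : i + j = n) :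
    ιF F L K i j n h ≫ ((mapC F).obj L ◁ (mapC F).map f).f n =
      (F.obj (L.X i) ◁ F.map (f.f j)) ≫ ιF F L K' i j n h :=
  ι_whiskerLeft ((mapC F).map f) ((mapC F).obj L) i j n h

lemma tensorComparison_whiskerRight {K K' : CochainComplex A ℤ} (f : K ⟶ K')
    (L : CochainComplex A ℤ) :
    (mapC F).map f ▷ (mapC F).obj L ≫ (tensorComparison F K' L).hom =
      (tensorComparison F K L).hom ≫ (mapC F).map (f ▷ L) := by
  refine HomologicalComplex.hom_ext _ _ (fun n ↦ ?_)
  refine (?_ : ((mapC F).map f ▷ (mapC F).obj L).f n ≫ tensorComparisonX F K' L n =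
    tensorComparisonX F K L n ≫ F.map ((f ▷ L).f n))
  refine ιF_hom_ext F K L (fun i j hij ↦ ?_)
  rw [← Category.assoc, ιF_whiskerRight, Category.assoc, ιF_tensorComparisonX,
    ιF_tensorComparisonX_assoc, ← F.map_comp, ι_whiskerRight, F.map_comp,
    μ_natural_left_assoc]

lemma tensorComparison_whiskerLeft {K K' : CochainComplex A ℤ} (f : K ⟶ K')
    (L : CochainComplex A ℤ) :
    (mapC F).obj L ◁ (mapC F).map f ≫ (tensorComparison F L K').hom =
      (tensorComparison F L K).hom ≫ (mapC F).map (L ◁ f) := by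
  refine HomologicalComplex.hom_ext _ _ (fun n ↦ ?_)
  refine (?_ : ((mapC F).obj L ◁ (mapC F).map f).f n ≫ tensorComparisonX F L K' n =
    tensorComparisonX F L K n ≫ F.map ((L ◁ f).f n))
  refine ιF_hom_ext F L K (fun i j hij ↦ ?_)
  rw [← Category.assoc, ιF_whiskerLeft, Category.assoc, ιF_tensorComparisonX,
    ιF_tensorComparisonX_assoc, ← F.map_comp, ι_whiskerLeft, F.map_comp,
    μ_natural_right_assoc]

end Comparison

section Exactness

variable {A : Type*} [Category* A] [Abelian A] [MonoidalCategory A] [MonoidalPreadditive A]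
  [HasColimitsOfSize.{0, 0} A]
  [∀ X : A, PreservesColimitsOfSize.{0, 0} ((curriedTensor A).obj X)]
  [∀ X : A, PreservesColimitsOfSize.{0, 0} ((curriedTensor A).flip.obj X)]

/-- Tensoring with any complex preserves quasi-isomorphisms between bounded above complexes. -/
class IsTensorExact (A : Type*) [Category* A] [Abelian A] [MonoidalCategory A]
    [MonoidalPreadditive A] [HasColimitsOfSize.{0, 0} A]
    [∀ X : A, PreservesColimitsOfSize.{0, 0} ((curriedTensor A).obj X)]
    [∀ X : A, PreservesColimitsOfSize.{0, 0} ((curriedTensor A).flip.obj X)] : Prop where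
  whiskerRight {K K' : CochainComplex A ℤ} (f : K ⟶ K') (L : CochainComplex A ℤ) (a b : ℤ)
    [K.IsStrictlyLE a] [K'.IsStrictlyLE b] [QuasiIso f] : QuasiIso (f ▷ L)
  whiskerLeft {K K' : CochainComplex A ℤ} (f : K ⟶ K') (L : CochainComplex A ℤ) (a b : ℤ)
    [K.IsStrictlyLE a] [K'.IsStrictlyLE b] [QuasiIso f] : QuasiIso (L ◁ f)

lemma isTensorExact_of_projective (h : ∀ X : A, Projective X) : IsTensorExact A where
  whiskerRight {K K'} f L a b _ _ hf := by
    have := K.isKProjective_of_projective a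
    have := K'.isKProjective_of_projective b
    rw [CochainComplex.IsKProjective.quasiIso_iff] at hf
    exact homotopyEquivalences_le_quasiIso A _ _ (homotopyEquivalences_whiskerRight hf L)
  whiskerLeft {K K'} f L a b _ _ hf := by
    have := K.isKProjective_of_projective a
    have := K'.isKProjective_of_projective b
    rw [CochainComplex.IsKProjective.quasiIso_iff] at hf
    exact homotopyEquivalences_le_quasiIso A _ _ (homotopyEquivalences_whiskerLeft hf L)

instance (k : Type*) [Field k] : IsTensorExact (ModuleCat k) :=
  isTensorExact_of_projective
    (fun M ↦ ModuleCat.projective_of_free (Module.Free.chooseBasis k M))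

variable (P : ObjectProperty A)

instance : (quasiIso P).IsMultiplicative := by
  dsimp only [quasiIso]
  infer_instance

variable [P.IsClosedUnderQuotients] [P.IsClosedUnderFiniteProducts] [P.IsMonoidal]

instance [IsTensorExact A] : (quasiIso P).IsMonoidal where
  whiskerRight := by
    rintro K K' f (hf : QuasiIso f.hom) L
    obtain ⟨a, _⟩ := K.property.2.1
    obtain ⟨b, _⟩ := K'.property.2.1
    exact IsTensorExact.whiskerRight f.hom L.obj a b
  whiskerLeft := by
    rintro L K K' f (hf : QuasiIso f.hom)
    obtain ⟨a, _⟩ := K.property.2.1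
    obtain ⟨b, _⟩ := K'.property.2.1
    exact IsTensorExact.whiskerLeft f.hom L.obj a b

end Exactness

section FunctorCategory

variable {J : Type*} [Category* J] {A : Type*} [Category* A] [MonoidalCategory A]

instance [Preadditive A] [MonoidalPreadditive A] : MonoidalPreadditive (J ⥤ A) where

instance [HasColimitsOfSize.{0, 0} A] (j : J) :
    PreservesColimitsOfSize.{0, 0} ((evaluation J A).obj j) := ⟨inferInstance⟩

instance (X : J ⥤ A) [HasColimitsOfSize.{0, 0} A]
    [∀ Y : A, PreservesColimitsOfSize.{0, 0} ((curriedTensor A).obj Y)] :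
    PreservesColimitsOfSize.{0, 0} ((curriedTensor (J ⥤ A)).obj X) :=
  preservesColimits_of_evaluation.{0, 0} _ (fun j ↦ preservesColimits_of_natIso
    (show (evaluation J A).obj j ⋙ (curriedTensor A).obj (X.obj j) ≅
        ((curriedTensor (J ⥤ A)).obj X) ⋙ (evaluation J A).obj j from
      NatIso.ofComponents (fun _ ↦ Iso.refl _)))

instance (X : J ⥤ A) [HasColimitsOfSize.{0, 0} A]
    [∀ Y : A, PreservesColimitsOfSize.{0, 0} ((curriedTensor A).flip.obj Y)] :
    PreservesColimitsOfSize.{0, 0} ((curriedTensor (J ⥤ A)).flip.obj X) :=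
  preservesColimits_of_evaluation.{0, 0} _ (fun j ↦ preservesColimits_of_natIso
    (show (evaluation J A).obj j ⋙ (curriedTensor A).flip.obj (X.obj j) ≅
        ((curriedTensor (J ⥤ A)).flip.obj X) ⋙ (evaluation J A).obj j from
      NatIso.ofComponents (fun _ ↦ Iso.refl _)))

/-- Evaluation at an object is monoidal for the pointwise monoidal structure. -/
instance (j : J) : ((evaluation J A).obj j).Monoidal :=
  Functor.CoreMonoidal.toMonoidal
    { εIso := Iso.refl _
      μIso _ _ := Iso.refl _ }

lemma isIso_map_homologyMap {C D : Type*} [Category* C] [Category* D] [Abelian C] [Abelian D]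
    (F : C ⥤ D) [F.Additive] [F.PreservesHomology] {S₁ S₂ : ShortComplex C} (φ : S₁ ⟶ S₂)
    (h : IsIso (ShortComplex.homologyMap (F.mapShortComplex.map φ))) :
    IsIso (F.map (ShortComplex.homologyMap φ)) := by
  have : F.map (ShortComplex.homologyMap φ) = (S₁.mapHomologyIso F).inv ≫
      ShortComplex.homologyMap (F.mapShortComplex.map φ) ≫ (S₂.mapHomologyIso F).hom := by
    rw [Iso.eq_inv_comp]
    exact (ShortComplex.mapHomologyIso_hom_naturality φ F).symm
  rw [this]
  exact IsIso.comp_isIso' (Iso.isIso_inv _) (IsIso.comp_isIso' h (Iso.isIso_hom _))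

lemma quasiIso_iff_evaluation {A : Type*} [Category* A] [Abelian A]
    {K L : CochainComplex (J ⥤ A) ℤ} (f : K ⟶ L) :
    QuasiIso f ↔
      ∀ j, QuasiIso ((((evaluation J A).obj j).mapHomologicalComplex (.up ℤ)).map f) := by
  refine ⟨fun _ j ↦ inferInstance, fun h ↦ ⟨fun i ↦ ?_⟩⟩
  rw [quasiIsoAt_iff_isIso_homologyMap, NatTrans.isIso_iff_isIso_app]
  intro j
  have h' := (h j).quasiIsoAt i
  rw [quasiIsoAt_iff_isIso_homologyMap] at h'
  exact isIso_map_homologyMap ((evaluation J A).obj j)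
    ((HomologicalComplex.shortComplexFunctor (J ⥤ A) (.up ℤ) i).map f) h'

instance {A : Type*} [Category* A] [Abelian A] [MonoidalCategory A] [MonoidalPreadditive A]
    [HasColimitsOfSize.{0, 0} A]
    [∀ X : A, PreservesColimitsOfSize.{0, 0} ((curriedTensor A).obj X)]
    [∀ X : A, PreservesColimitsOfSize.{0, 0} ((curriedTensor A).flip.obj X)]
    [IsTensorExact A] : IsTensorExact (J ⥤ A) where
  whiskerRight {K K'} f L a b _ _ hf := by
    rw [quasiIso_iff_evaluation] at hf ⊢
    intro j
    have := hf j
    have := IsTensorExact.whiskerRight ((mapC ((evaluation J A).obj j)).map f)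
      ((mapC ((evaluation J A).obj j)).obj L) a b
    have e := tensorComparison_whiskerRight ((evaluation J A).obj j) f L
    rw [← Iso.inv_comp_eq] at e
    rw [← e]
    infer_instance
  whiskerLeft {K K'} f L a b _ _ hf := by
    rw [quasiIso_iff_evaluation] at hf ⊢
    intro j
    have := hf j
    have := IsTensorExact.whiskerLeft ((mapC ((evaluation J A).obj j)).map f)
      ((mapC ((evaluation J A).obj j)).obj L) a b
    have e := tensorComparison_whiskerLeft ((evaluation J A).obj j) f L
    rw [← Iso.inv_comp_eq] at e
    rw [← e]
    infer_instance

end FunctorCategory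
section Functoriality

variable {A : Type*} [Category* A] [Abelian A] (P : ObjectProperty A)
  [P.IsClosedUnderQuotients] [P.IsClosedUnderFiniteProducts]

/-- The cohomology functor `Hⁱ` on `Dᵇ(P)`. -/
noncomputable def cohomology (i : ℤ) : Db P ⥤ A :=
  Localization.lift ((hBounded P).ι ⋙ HomotopyCategory.homologyFunctor A (.up ℤ) i)
    (fun _ _ f (hf : hQuasiIso P f) ↦ hf i) (Qh P)

variable {A' : Type*} [Category* A'] [Abelian A'] {P} (P' : ObjectProperty A')
  [P'.IsClosedUnderQuotients] [P'.IsClosedUnderFiniteProducts]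
  (F : A ⥤ A') [F.Additive]

lemma bounded_mapHomologicalComplex (hF : P ≤ P'.inverseImage F)
    (K : CochainComplex A ℤ) (hK : bounded P K) :
    bounded P' ((F.mapHomologicalComplex (.up ℤ)).obj K) := by
  obtain ⟨⟨a, _⟩, ⟨b, _⟩, hP⟩ := hK
  exact ⟨⟨a, inferInstance⟩, ⟨b, inferInstance⟩, fun i ↦ hF _ (hP i)⟩

variable (hF : P ≤ P'.inverseImage F)

/-- The functor `Kᵇ(P) ⥤ Kᵇ(P')` given by applying `F` termwise. -/
noncomputable def mapKb : Kb P ⥤ Kb P' :=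
  ObjectProperty.lift _ ((hBounded P).ι ⋙ F.mapHomotopyCategory (.up ℤ)) (fun K ↦ by
    obtain ⟨K, rfl⟩ := quotient_obj_surjective P K
    exact (hBounded_quotient_iff P' _).2 (bounded_mapHomologicalComplex P' F hF _ K.property))

lemma mapKb_hQuasiIso [PreservesFiniteLimits F] [PreservesFiniteColimits F]
    {K L : Kb P} (f : K ⟶ L) (hf : hQuasiIso P f) : hQuasiIso P' ((mapKb P' F hF).map f) := by
  obtain ⟨K, rfl⟩ := quotient_obj_surjective P K
  obtain ⟨L, rfl⟩ := quotient_obj_surjective P L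
  obtain ⟨f, rfl⟩ := (quotient P).map_surjective f
  rw [quotient_map_mem_iff] at hf
  have : QuasiIso f.hom := hf
  exact (HomotopyCategory.quotient_map_mem_quasiIso_iff
    ((F.mapHomologicalComplex (.up ℤ)).map f.hom)).2
      (inferInstanceAs (QuasiIso ((F.mapHomologicalComplex (.up ℤ)).map f.hom)))

/-- The functor `Dᵇ(P) ⥤ Dᵇ(P')` induced by an exact functor `F`, given by applying `F` to
complexes term by term. -/
noncomputable def mapDb [PreservesFiniteLimits F] [PreservesFiniteColimits F] : Db P ⥤ Db P' :=
  Localization.lift (mapKb P' F hF ⋙ Qh P')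
    (fun _ _ f (hf : hQuasiIso P f) ↦
      Localization.inverts (Qh P') (hQuasiIso P') _ (mapKb_hQuasiIso P' F hF f hf)) (Qh P)

end Functoriality
section VectorSpaces

variable (k : Type u) [Field k]

lemma finite_of_isLimit {J : Type*} [Finite J] {D : Discrete J ⥤ ModuleCat.{u} k} {c : Cone D}
    (hc : IsLimit c) (h : ∀ j, Module.Finite k (D.obj j)) : Module.Finite k c.pt := by
  let f : c.pt →ₗ[k] ∀ j, D.obj j := LinearMap.pi (fun j ↦ (c.π.app j).hom)
  have hf : Function.Injective f := fun x y hxy ↦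
    Concrete.isLimit_ext D hc _ _ (fun j ↦ congr_fun hxy j)
  have : Finite (Discrete J) := Finite.of_equiv J discreteEquiv.symm
  exact Module.Finite.of_injective f hf

instance : (ModuleCat.isFG.{u} k).IsClosedUnderQuotients where
  prop_of_epi f _ (_ : Module.Finite k _) :=
    Module.Finite.of_surjective f.hom ((ModuleCat.epi_iff_surjective f).1 inferInstance)

instance : (ModuleCat.isFG.{u} k).IsClosedUnderFiniteProducts where
  isClosedUnderLimitsOfShape J _ :=
    ⟨by
      rintro X ⟨p⟩
      exact finite_of_isLimit k p.isLimit p.prop_diag_obj⟩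

instance {C : Type*} [Category* C] : (⊤ : ObjectProperty C).IsClosedUnderFiniteProducts where

instance {C : Type*} [Category* C] [MonoidalCategory C] : (⊤ : ObjectProperty C).IsMonoidal where
  prop_unit := trivial
  prop_tensor _ _ _ _ := trivial

lemma isFG_le (P : ObjectProperty (ModuleCat.{u} k)) [P.IsClosedUnderQuotients]
    [P.IsClosedUnderFiniteProducts] [P.IsMonoidal] : ModuleCat.isFG.{u} k ≤ P := by
  intro M (hM : Module.Finite k M)
  let f : Fin (Module.finrank k M) → ModuleCat.{u} k := fun _ ↦ 𝟙_ _
  have h₁ : P (⨁ f) := P.prop_of_isLimit_fan (biproduct.isLimit f) (fun _ ↦ P.prop_unit)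
  let e : (Fin (Module.finrank k M) → k) ≃ₗ[k] M := (Module.finBasis k M).equivFun.symm
  exact P.prop_of_iso (ModuleCat.biproductIsoPi f ≪≫
    LinearEquiv.toModuleIso (X₁ := ∀ j, f j) (X₂ := M) e) h₁

end VectorSpaces

end BoundedDerived

open BoundedDerived

namespace QuiverRep

variable (k : Type u) [Field k] (V : Type v) [Quiver.{w} V]

/-- Representations of the quiver `V`, of arbitrary dimension, as functors on the path category.
Its monoidal structure is the vertexwise tensor product; the unit has `k` at every vertex and
the identity at every arrow. -/
abbrev Rep := Paths V ⥤ ModuleCat.{u} k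

/-- A set of relations on `V`: for any two vertices `a`, `b` a set of `k`-linear combinations
of paths from `a` to `b`. -/
abbrev Relations := ∀ a b : V, Set (Quiver.Path a b →₀ k)

variable {k V}

/-- The vector space `M_n` at the vertex `n`. -/
abbrev vertex (n : V) : Rep k V ⥤ ModuleCat.{u} k := (evaluation _ _).obj ((Paths.of V).obj n)

/-- The action of a linear combination of paths on a representation. -/
noncomputable def act (M : Rep k V) {a b : V} (r : Quiver.Path a b →₀ k) :
    (vertex a).obj M ⟶ (vertex b).obj M :=
  r.sum (fun p c ↦ c • M.map (X := (Paths.of V).obj a) (Y := (Paths.of V).obj b) p)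

lemma act_naturality {M N : Rep k V} (f : M ⟶ N) {a b : V} (r : Quiver.Path a b →₀ k) :
    act M r ≫ (vertex b).map f = (vertex a).map f ≫ act N r := by
  simp only [act, Finsupp.sum, Preadditive.sum_comp, Preadditive.comp_sum]
  refine Finset.sum_congr rfl (fun p _ ↦ ?_)
  rw [Linear.smul_comp, Linear.comp_smul]
  congr 1
  exact f.naturality _

/-- `M` satisfies the relations `R`. -/
def Satisfies (R : Relations k V) (M : Rep k V) : Prop :=
  ∀ (a b : V), ∀ r ∈ R a b, act M r = 0

/-- The finite-dimensional representations satisfying the relations `R`. -/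
def finRep (R : Relations k V) : ObjectProperty (Rep k V) := fun M ↦
  (∀ n : V, Module.Finite k ((vertex n).obj M)) ∧ Satisfies R M

/-- `R` is a set of tensor relations: only non-trivial paths occur in `R`, and the
representations satisfying `R` contain the unit and are closed under the vertexwise tensor
product. -/
class Relations.IsTensor (R : Relations k V) : Prop where
  length_pos (a b : V) (r : Quiver.Path a b →₀ k) (hr : r ∈ R a b)
    (p : Quiver.Path a b) (hp : p ∈ r.support) : 0 < p.length
  satisfies_unit : Satisfies R (𝟙_ (Rep k V))
  satisfies_tensor (M N : Rep k V) (hM : finRep R M) (hN : finRep R N) : Satisfies R (M ⊗ N)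

variable (R : Relations k V)

instance : (finRep R).IsClosedUnderQuotients where
  prop_of_epi {M N} f _ h := by
    refine ⟨fun n ↦ ?_, fun a b r hr ↦ ?_⟩
    · exact (ModuleCat.isFG k).prop_of_epi ((vertex n).map f) (h.1 n)
    · rw [← cancel_epi ((vertex a).map f), ← act_naturality, h.2 a b r hr, zero_comp, comp_zero]

instance : (finRep R).IsClosedUnderFiniteProducts where
  isClosedUnderLimitsOfShape J _ :=
    ⟨by
      rintro M ⟨p⟩
      refine ⟨fun n ↦ ?_, fun a b r hr ↦ ?_⟩
      · exact finite_of_isLimit k (isLimitOfPreserves (vertex n) p.isLimit)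
          (fun j ↦ (p.prop_diag_obj j).1 n)
      · refine (isLimitOfPreserves (vertex b) p.isLimit).hom_ext (fun j ↦ ?_)
        refine (act_naturality (p.π.app j) r).trans ?_
        rw [(p.prop_diag_obj j).2 a b r hr, comp_zero, zero_comp]⟩

instance [R.IsTensor] : (finRep R).IsMonoidal where
  prop_unit := ⟨fun _ ↦ Module.Finite.self k, Relations.IsTensor.satisfies_unit⟩
  prop_tensor M N hM hN :=
    ⟨fun n ↦ ObjectProperty.prop_tensor (P₁ := ModuleCat.isFG k) (P₂ := ModuleCat.isFG k)
        (Q := ModuleCat.isFG k) (hM.1 n) (hN.1 n),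
      Relations.IsTensor.satisfies_tensor M N hM hN⟩

/-- `D(Q) = Dᵇ((Q, R)-Rep)`. -/
abbrev D := Db (finRep R)

/-- The functor `D(Q) ⥤ Dᵇ(k)` sending a complex of representations to its complex of vector
spaces at the vertex `n`. Here `Dᵇ(k) = Dᵇ(Vect)`, where `Vect` may be the category of
finite-dimensional vector spaces, `ModuleCat.isFG k`, or that of all vector spaces, `⊤`. -/
noncomputable def vertexFunctor (Vect : ObjectProperty (ModuleCat.{u} k))
    [Vect.IsClosedUnderQuotients] [Vect.IsClosedUnderFiniteProducts] [Vect.IsMonoidal] (n : V) :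
    D R ⥤ Db Vect :=
  mapDb Vect (vertex n) (fun M (hM : finRep R M) ↦ isFG_le k Vect _ (hM.1 n))

end QuiverRep

namespace TensorTriangulated

section Functors

variable (k : Type*) [Field k]
  {T : Type*} [Category* T] [Preadditive T] [HasZeroObject T] [HasShift T ℤ]
  [∀ n : ℤ, (shiftFunctor T n).Additive] [Pretriangulated T] [CategoryTheory.Linear k T]
  [MonoidalCategory T]
  {S : Type*} [Category* S] [Preadditive S] [HasZeroObject S] [HasShift S ℤ]
  [∀ n : ℤ, (shiftFunctor S n).Additive] [Pretriangulated S] [CategoryTheory.Linear k S]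
  [MonoidalCategory S]

/-- `F` is a morphism of `k`-linear tensor triangulated categories: it is `k`-linear and exact,
and preserves tensor products and the unit. -/
structure IsTTFunctor (F : T ⥤ S) : Prop where
  additive : F.Additive
  linear : F.Linear k
  exact : ∃ _ : F.CommShift ℤ, F.IsTriangulated
  monoidal : Nonempty F.Monoidal

variable (T S) in
/-- The category of exact unit-preserving tensor functors `T ⥤ S`. Its morphisms are all natural
transformations. -/
abbrev TTFunctor := ObjectProperty.FullSubcategory (fun F : T ⥤ S ↦ IsTTFunctor k F)

variable (T S) in
/-- The set `T(S)` of `S`-valued points of `T`: the isomorphism classes of exact unit-preserving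
tensor functors `T ⥤ S`. -/
def Points := Quotient (isIsomorphicSetoid (TTFunctor k T S))

/-- The point given by a functor. -/
def Points.mk (F : T ⥤ S) (hF : IsTTFunctor k F) : Points k T S :=
  Quotient.mk (isIsomorphicSetoid (TTFunctor k T S)) ⟨F, hF⟩

/-- The full subcategory `ker F` of the objects that are sent to zero by a functor `F`. It only
depends on the isomorphism class of `F`. -/
def Points.ker (x : Points k T S) : ObjectProperty T :=
  Quotient.lift (s := isIsomorphicSetoid (TTFunctor k T S)) (fun F X ↦ IsZero (F.obj.obj X))
    (by
      rintro F G ⟨e⟩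
      ext X
      exact (((ObjectProperty.ι _).mapIso e).app X).isZero_iff) x

end Functors

section Spectrum

variable (T : Type*) [Category* T] [Preadditive T] [HasZeroObject T] [HasShift T ℤ]
  [∀ n : ℤ, (shiftFunctor T n).Additive] [Pretriangulated T] [MonoidalCategory T]

variable {T} in
/-- A prime tensor ideal: a proper, thick (closed under retracts), triangulated full subcategory
`P` such that `X ⊗ Y` lies in `P` if `X` lies in `P`, and only if `X` or `Y` lies in `P`. -/
structure IsPrime (P : ObjectProperty T) : Prop where
  isTriangulated : P.IsTriangulated
  isStableUnderRetracts : P.IsStableUnderRetracts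
  tensor_mem (X Y : T) (hX : P X) : P (X ⊗ Y)
  proper : ∃ X, ¬ P X
  mem_or_mem (X Y : T) (h : P (X ⊗ Y)) : P X ∨ P Y

/-- The set of points of the spectrum of `T`. -/
def Spc := { P : ObjectProperty T // IsPrime P }

end Spectrum

end TensorTriangulated

open QuiverRep TensorTriangulated

/-! Write `F_n` for the vertex functor at `n`. Termwise evaluation is exact and strong monoidal on
complexes, so `F_n` is a tensor triangulated functor that commutes with cohomology. Two complexes of
vector spaces with nonzero cohomology have summands `k[-i]` and `k[-j]`, and the product of these is
not acyclic. Hence a tensor product in `Dᵇ(k)` vanishes only if a factor does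
(`isZero_tensor_Db_iff`), and kernels of points are prime.

The `F_n` together detect zero objects, since cohomology is computed vertexwise. As there are
finitely many vertices, a prime `P` contains some `ker F_n`: otherwise the tensor product of objects
of `ker F_n` outside `P`, one for each `n`, would lie outside `P` and yet be zero
(`IsPrime.exists_kernel_le`).

Acyclicity of the quiver makes each vertex split off up to `ker F_n`. Let `M'` be the part of a
representation `M` supported on the vertices reached from `n`, and `S_n(W)` the representation with
`W` at `n` and zero elsewhere. Then `M'` is a subrepresentation of `M`, and no nontrivial path leads
from its support back to `n`, so it projects onto `S_n(M_n)`. Both legs of the natural roof `M ← M'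
→ S_n(M_n)` are isomorphisms at `n`, so on complexes their cones lie in `ker F_n`.

Consequently, if `ker F_n ≤ P` with `P` prime, then `P = ker F_n`: an object of `P` outside `ker
F_n` puts some shift of `S_n(k)` into `P` as a retract, and with it the unit, which the roof links
to `S_n(k)` (`eq_kernel_of_kernel_le`). Likewise a point `F` with `ker F_n ≤ ker F` is determined on
`Kᵇ` by its composite with `S_n` on complexes of finite-dimensional vector spaces. There every
object is a finite sum of shifts of `k`, and `F(S_n(k)) ≅ F(𝟙) ≅ 𝟙`, so `F ≅ F_n` by linearity
(`nonempty_iso_vertexFunctor`). Distinct vertices are separated by the objects `S_n(k)`. -/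

namespace BoundedDerived

/-! ### Exact functors between bounded derived categories, and cohomology -/

section Functoriality

variable {A : Type*} [Category* A] [Abelian A] {P : ObjectProperty A}
  [P.IsClosedUnderQuotients] [P.IsClosedUnderFiniteProducts]
  {A' : Type*} [Category* A'] [Abelian A'] (P' : ObjectProperty A')
  [P'.IsClosedUnderQuotients] [P'.IsClosedUnderFiniteProducts]
  (F : A ⥤ A') [F.Additive] (hF : P ≤ P'.inverseImage F)

noncomputable instance : (mapKb P' F hF).CommShift ℤ := by
  dsimp only [mapKb]
  infer_instance

instance : (mapKb P' F hF).IsTriangulated := by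
  dsimp only [mapKb]
  infer_instance

instance (R : Type*) [Ring R] [CategoryTheory.Linear R A] [CategoryTheory.Linear R A']
    [F.Linear R] : (mapKb P' F hF).Linear R where
  map_smul f r := by
    ext
    exact (F.mapHomotopyCategory (.up ℤ)).map_smul r f.hom

instance (R : Type*) [Ring R] [CategoryTheory.Linear R A] : (quotient P).Linear R where
  map_smul f r := by
    ext
    exact (HomotopyCategory.quotient A (.up ℤ)).map_smul r f.hom

instance : (quotient P).Additive where

instance : (Q P).Additive := by dsimp only [Q]; infer_instance

section Exact

variable [PreservesFiniteLimits F] [PreservesFiniteColimits F]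

noncomputable instance :
    Localization.Lifting (Qh P) (hQuasiIso P) (mapKb P' F hF ⋙ Qh P') (mapDb P' F hF) :=
  ⟨Localization.fac _ _ _⟩

/-- `mapDb` is induced by `mapKb`. -/
noncomputable def mapDbFactors : Qh P ⋙ mapDb P' F hF ≅ mapKb P' F hF ⋙ Qh P' :=
  Localization.Lifting.iso (Qh P) (hQuasiIso P) (mapKb P' F hF ⋙ Qh P') (mapDb P' F hF)

instance : (hQuasiIso P).HasLeftCalculusOfFractions := by
  rw [hQuasiIso_eq_trW]
  infer_instance

noncomputable instance : (mapDb P' F hF).CommShift ℤ :=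
  Functor.commShiftOfLocalization (Qh P) (hQuasiIso P) ℤ (mapKb P' F hF ⋙ Qh P') _

instance : NatTrans.CommShift (mapDbFactors P' F hF).hom ℤ :=
  inferInstanceAs (NatTrans.CommShift (Localization.Lifting.iso (Qh P) (hQuasiIso P)
    (mapKb P' F hF ⋙ Qh P') (mapDb P' F hF)).hom ℤ)

/-- Lifting arrows, hence distinguished triangles, to `Kᵇ(P)` is what allows exactness of a functor
on `Dᵇ(P)` to be tested after composing with `Qh`. -/
instance : (Qh P).mapArrow.EssSurj := by
  exact Localization.essSurj_mapArrow (Qh P) (acyclic P).trW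

instance : (mapDb P' F hF).IsTriangulated :=
  Functor.isTriangulated_of_precomp_iso (mapDbFactors P' F hF)

instance (R : Type*) [Ring R] [CategoryTheory.Linear R A] [CategoryTheory.Linear R A']
    [F.Linear R] : (mapDb P' F hF).Linear R := by
  rw [← Localization.functor_linear_iff (Qh P) (hQuasiIso P) R (mapKb P' F hF ⋙ Qh P')]
  infer_instance

end Exact

section Cohomology

noncomputable instance (i : ℤ) : Localization.Lifting (Qh P) (hQuasiIso P)
    ((hBounded P).ι ⋙ HomotopyCategory.homologyFunctor A (.up ℤ) i) (cohomology P i) :=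
  ⟨Localization.fac _ _ _⟩

variable (P) in
/-- The cohomology of an object of `Kᵇ(P)`. -/
noncomputable def cohomologyFactors (i : ℤ) :
    Qh P ⋙ cohomology P i ≅ (hBounded P).ι ⋙ HomotopyCategory.homologyFunctor A (.up ℤ) i :=
  Localization.Lifting.iso (Qh P) (hQuasiIso P) _ _

variable (P) in
/-- The cohomology of an object of `Cᵇ(P)`. -/
noncomputable def QCohomology (i : ℤ) :
    Q P ⋙ cohomology P i ≅ (bounded P).ι ⋙ HomologicalComplex.homologyFunctor A (.up ℤ) i :=
  Functor.isoWhiskerLeft (quotient P) (cohomologyFactors P i) ≪≫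
    Functor.isoWhiskerLeft (bounded P).ι (HomotopyCategory.homologyFunctorFactors A (.up ℤ) i)

lemma isZero_cohomology {X : Db P} (hX : IsZero X) (i : ℤ) :
    IsZero ((cohomology P i).obj X) := by
  have : (cohomology P i).PreservesZeroMorphisms := by
    have : (cohomology P i).Additive := by
      rw [Localization.functor_additive_iff (Qh P) (hQuasiIso P)]
      exact Functor.additive_of_iso (cohomologyFactors P i).symm
    infer_instance
  exact Functor.map_isZero _ hX

instance : (Qh P).EssSurj := Localization.essSurj (Qh P) (hQuasiIso P)

instance : (Q P).EssSurj := Localization.essSurj (Q P) (quasiIso P)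

/-- If all cohomology vanishes, the zero endomorphism of `K` is a quasi-isomorphism, so zero becomes
invertible in `Dᵇ(P)`. -/
lemma isZero_Q_iff (K : Cb P) :
    IsZero ((Q P).obj K) ↔ ∀ i, IsZero (K.obj.homology i) := by
  refine ⟨fun h i ↦ (isZero_cohomology h i).of_iso ((QCohomology P i).app K).symm, fun h ↦ ?_⟩
  have : quasiIso P (0 : K ⟶ K) := by
    change QuasiIso (0 : K.obj ⟶ K.obj)
    refine ⟨fun i ↦ ?_⟩
    rw [quasiIsoAt_iff_isIso_homologyMap]
    exact ⟨0, (h i).eq_of_src _ _, (h i).eq_of_src _ _⟩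
  have h' := Localization.inverts (Q P) (quasiIso P) _ this
  rw [Functor.map_zero] at h'
  exact (isIsoZero_iff_source_target_isZero _ _).1 h' |>.1

end Cohomology

end Functoriality

end BoundedDerived

namespace BoundedDerived

section Functoriality

variable {A : Type*} [Category* A] [Abelian A] {P : ObjectProperty A}
  [P.IsClosedUnderQuotients] [P.IsClosedUnderFiniteProducts]
  {A' : Type*} [Category* A'] [Abelian A'] (P' : ObjectProperty A')
  [P'.IsClosedUnderQuotients] [P'.IsClosedUnderFiniteProducts]
  (F : A ⥤ A') [F.Additive] (hF : P ≤ P'.inverseImage F)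

/-- The functor `Cᵇ(P) ⥤ Cᵇ(P')` given by applying `F` termwise. -/
noncomputable def mapCb : Cb P ⥤ Cb P' :=
  ObjectProperty.lift _ ((bounded P).ι ⋙ F.mapHomologicalComplex (.up ℤ))
    (fun K ↦ bounded_mapHomologicalComplex P' F hF _ K.property)

/-- `mapKb` is induced by `mapCb`. -/
noncomputable def mapKbFactors :
    quotient P ⋙ mapKb P' F hF ≅ mapCb P' F hF ⋙ quotient P' :=
  NatIso.ofComponents (fun _ ↦ Iso.refl _) (fun f ↦ by
    refine (Category.comp_id _).trans (Eq.trans ?_ (Category.id_comp _).symm)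
    ext
    exact F.mapHomotopyCategory_map f.hom)

variable [PreservesFiniteLimits F] [PreservesFiniteColimits F]

/-- `mapDb` is induced by `mapCb`. -/
noncomputable def QMapDb : Q P ⋙ mapDb P' F hF ≅ mapCb P' F hF ⋙ Q P' :=
  Functor.isoWhiskerLeft (quotient P) (mapDbFactors P' F hF) ≪≫
    Functor.isoWhiskerRight (mapKbFactors P' F hF) (Qh P')

/-- The lifting is stated along `Q` and not only along `Qh`, because the tensor product of `Dᵇ` is
obtained by localizing the one on `Cᵇ`. -/
noncomputable instance :
    Localization.Lifting (Q P) (quasiIso P) (mapCb P' F hF ⋙ Q P') (mapDb P' F hF) :=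
  ⟨QMapDb P' F hF⟩

/-- An exact functor commutes with the homology of complexes. -/
noncomputable def mapHomologyIso (i : ℤ) :
    F.mapHomologicalComplex (.up ℤ) ⋙ HomologicalComplex.homologyFunctor A' (.up ℤ) i ≅
      HomologicalComplex.homologyFunctor A (.up ℤ) i ⋙ F :=
  NatIso.ofComponents (fun K ↦ (K.sc i).mapHomologyIso F) (fun f ↦
    ShortComplex.mapHomologyIso_hom_naturality
      ((HomologicalComplex.shortComplexFunctor A (.up ℤ) i).map f) F)

/-- The functor `mapDb` commutes with cohomology. -/
noncomputable def mapDbCohomology (i : ℤ) :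
    mapDb P' F hF ⋙ cohomology P' i ≅ cohomology P i ⋙ F :=
  Localization.liftNatIso (Q P) (quasiIso P)
    (Q P ⋙ mapDb P' F hF ⋙ cohomology P' i) (Q P ⋙ cohomology P i ⋙ F) _ _
    (Functor.isoWhiskerRight (QMapDb P' F hF) (cohomology P' i) ≪≫
      Functor.isoWhiskerLeft (mapCb P' F hF) (QCohomology P' i) ≪≫
      Functor.isoWhiskerLeft (bounded P).ι (mapHomologyIso F i) ≪≫
      Functor.isoWhiskerRight (QCohomology P i).symm F)

end Functoriality

/-! ### The structure maps of the tensor product of complexes, on summands -/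

section Monoidal

variable {A : Type*} [Category* A] [Abelian A] [MonoidalCategory A] [MonoidalPreadditive A]
  [HasColimitsOfSize.{0, 0} A]
  [∀ X : A, PreservesColimitsOfSize.{0, 0} ((curriedTensor A).obj X)]
  [∀ X : A, PreservesColimitsOfSize.{0, 0} ((curriedTensor A).flip.obj X)]
  {A' : Type*} [Category* A'] [Abelian A'] [MonoidalCategory A'] [MonoidalPreadditive A']
  [HasColimitsOfSize.{0, 0} A']
  [∀ X : A', PreservesColimitsOfSize.{0, 0} ((curriedTensor A').obj X)]
  [∀ X : A', PreservesColimitsOfSize.{0, 0} ((curriedTensor A').flip.obj X)]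

open HomologicalComplex

/-- The intermediate degrees `a` and `b` are variables subject to equations, so that later rewriting
needs no transport between equal degrees. -/
lemma ι_associator_hom (K L M : CochainComplex A ℤ) (i j l n a b : ℤ) (ha : i + j = a)
    (han : a + l = n) (hb : j + l = b) (hbn : i + b = n) :
    (ιTensorObj K L i j a ha ▷ M.X l) ≫ ιTensorObj (K ⊗ L) M a l n han ≫ (α_ K L M).hom.f n =
      (α_ (K.X i) (L.X j) (M.X l)).hom ≫ (K.X i ◁ ιTensorObj L M j l b hb) ≫
        ιTensorObj K (L ⊗ M) i b n hbn := by
  subst ha hb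
  have h := ι_mapBifunctorAssociatorX_hom (curriedAssociatorNatIso A) K L M
    (.up ℤ) (.up ℤ) (.up ℤ) i j l n (by exact han)
  rw [mapBifunctor₁₂.ι_eq _ _ _ _ _ _ _ _ _ _ (i + j) _ rfl han,
    mapBifunctor₂₃.ι_eq _ _ _ _ _ _ _ _ _ _ _ (j + l) _ rfl hbn] at h
  exact (Category.assoc _ _ _).symm.trans h

variable (A) in
/-- The inclusion of the unit in the unit complex. -/
noncomputable def unitX : 𝟙_ A ⟶ (𝟙_ (CochainComplex A ℤ)).X 0 :=
  (singleObjXSelf (.up ℤ) 0 (𝟙_ A)).inv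

/-- The inverse of the unitor is the convenient direction: it lands in the single summand `(0, n)`,
so no case distinction on degrees occurs. -/
lemma leftUnitor_inv_f (K : CochainComplex A ℤ) (n : ℤ) :
    (λ_ K).inv.f n = (λ_ (K.X n)).inv ≫
      (unitX A ▷ K.X n) ≫
        ιTensorObj (𝟙_ (CochainComplex A ℤ)) K 0 n n (zero_add n) :=
  leftUnitor'_inv K n

lemma rightUnitor_inv_f (K : CochainComplex A ℤ) (n : ℤ) :
    (ρ_ K).inv.f n = (ρ_ (K.X n)).inv ≫
      (K.X n ◁ unitX A) ≫
        ιTensorObj K (𝟙_ (CochainComplex A ℤ)) n 0 n (add_zero n) :=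
  rightUnitor'_inv K n

lemma tensor₃_hom_ext (K L M : CochainComplex A ℤ) {n : ℤ} {Y : A}
    {f g : ((K ⊗ L) ⊗ M).X n ⟶ Y}
    (h : ∀ (i j l a : ℤ) (ha : i + j = a) (han : a + l = n),
      (ιTensorObj K L i j a ha ▷ M.X l) ≫ ιTensorObj (K ⊗ L) M a l n han ≫ f =
        (ιTensorObj K L i j a ha ▷ M.X l) ≫ ιTensorObj (K ⊗ L) M a l n han ≫ g) : f = g := by
  refine mapBifunctor₁₂.hom_ext (F₁₂ := curriedTensor A) (G := curriedTensor A) (K₁ := K)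
    (K₂ := L) (K₃ := M) (c₁₂ := .up ℤ) (c₄ := .up ℤ) (fun i j l hn ↦ ?_)
  have := h i j l (i + j) rfl hn
  rw [mapBifunctor₁₂.ι_eq _ _ _ _ _ _ _ _ _ _ (i + j) _ rfl hn]
  exact (Category.assoc _ _ _).trans (this.trans (Category.assoc _ _ _).symm)

end Monoidal

end BoundedDerived

/-! ### Termwise application of a monoidal functor is monoidal on complexes -/

namespace BoundedDerived

section Monoidal

variable {A : Type*} [Category* A] [Abelian A] [MonoidalCategory A] [MonoidalPreadditive A]
  [HasColimitsOfSize.{0, 0} A]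
  [∀ X : A, PreservesColimitsOfSize.{0, 0} ((curriedTensor A).obj X)]
  [∀ X : A, PreservesColimitsOfSize.{0, 0} ((curriedTensor A).flip.obj X)]
  {A' : Type*} [Category* A'] [Abelian A'] [MonoidalCategory A'] [MonoidalPreadditive A']
  [HasColimitsOfSize.{0, 0} A']
  [∀ X : A', PreservesColimitsOfSize.{0, 0} ((curriedTensor A').obj X)]
  [∀ X : A', PreservesColimitsOfSize.{0, 0} ((curriedTensor A').flip.obj X)]

open HomologicalComplex Functor.LaxMonoidal

variable (F : A ⥤ A') [F.Monoidal] [F.Additive] [PreservesColimitsOfSize.{0, 0} F]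

/-- The inclusion of a summand of `(F K ⊗ F L) ⊗ F M`. -/
noncomputable def ιFLeft (K L M : CochainComplex A ℤ) (a l n : ℤ) (h : a + l = n) :
    ((mapC F).obj K ⊗ (mapC F).obj L).X a ⊗ F.obj (M.X l) ⟶
      (((mapC F).obj K ⊗ (mapC F).obj L) ⊗ (mapC F).obj M).X n :=
  ιTensorObj ((mapC F).obj K ⊗ (mapC F).obj L) ((mapC F).obj M) a l n h

/-- The inclusion of a summand of `F K ⊗ (F L ⊗ F M)`. -/
noncomputable def ιFRight (K L M : CochainComplex A ℤ) (i b n : ℤ) (h : i + b = n) :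
    F.obj (K.X i) ⊗ ((mapC F).obj L ⊗ (mapC F).obj M).X b ⟶
      ((mapC F).obj K ⊗ ((mapC F).obj L ⊗ (mapC F).obj M)).X n :=
  ιTensorObj ((mapC F).obj K) ((mapC F).obj L ⊗ (mapC F).obj M) i b n h

lemma ιFLeft_tensorComparison_whiskerRight (K L M : CochainComplex A ℤ) (a l n : ℤ)
    (h : a + l = n) :
    ιFLeft F K L M a l n h ≫ ((tensorComparison F K L).hom ▷ (mapC F).obj M).f n =
      (tensorComparisonX F K L a ▷ F.obj (M.X l)) ≫ ιF F (K ⊗ L) M a l n h :=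
  ι_whiskerRight _ _ _ _ _ _

lemma ιFRight_tensorComparison_whiskerLeft (K L M : CochainComplex A ℤ) (i b n : ℤ)
    (h : i + b = n) :
    ιFRight F K L M i b n h ≫ ((mapC F).obj K ◁ (tensorComparison F L M).hom).f n =
      (F.obj (K.X i) ◁ tensorComparisonX F L M b) ≫ ιF F K (L ⊗ M) i b n h :=
  ι_whiskerLeft _ _ _ _ _ _

lemma ιF_associator (K L M : CochainComplex A ℤ) (i j l n a b : ℤ) (ha : i + j = a)
    (han : a + l = n) (hb : j + l = b) (hbn : i + b = n) :
    (ιF F K L i j a ha ▷ F.obj (M.X l)) ≫ ιFLeft F K L M a l n han ≫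
        (α_ ((mapC F).obj K) ((mapC F).obj L) ((mapC F).obj M)).hom.f n =
      (α_ (F.obj (K.X i)) (F.obj (L.X j)) (F.obj (M.X l))).hom ≫
        (F.obj (K.X i) ◁ ιF F L M j l b hb) ≫ ιFRight F K L M i b n hbn :=
  ι_associator_hom ((mapC F).obj K) ((mapC F).obj L) ((mapC F).obj M) i j l n a b ha han hb hbn

/-- On each summand `(i, j, l)` this is the associativity of `μ F` on `K.X i`, `L.X j`, `M.X l`,
combined with naturality of `μ F` in the inclusions of summands. -/
lemma tensorComparison_associativity_f (K L M : CochainComplex A ℤ) (n : ℤ) :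
    ((tensorComparison F K L).hom ▷ (mapC F).obj M).f n ≫ tensorComparisonX F (K ⊗ L) M n ≫
        F.map ((α_ K L M).hom.f n) =
      (α_ ((mapC F).obj K) ((mapC F).obj L) ((mapC F).obj M)).hom.f n ≫
        ((mapC F).obj K ◁ (tensorComparison F L M).hom).f n ≫ tensorComparisonX F K (L ⊗ M) n := by
  refine tensor₃_hom_ext _ _ _ (fun i j l a ha han ↦ ?_)
  -- The same inclusions, with the terms of the complexes spelled `F.obj (K.X i)`, the form in which
  -- naturality of `μ F` can be rewritten.
  change (ιF F K L i j a ha ▷ F.obj (M.X l)) ≫ ιFLeft F K L M a l n han ≫ _ =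
    (ιF F K L i j a ha ▷ F.obj (M.X l)) ≫ ιFLeft F K L M a l n han ≫ _
  have h₁ := ιF_associator F K L M i j l n a (j + l) ha han rfl (by lia)
  have h₂ := ιFLeft_tensorComparison_whiskerRight F K L M a l n han
  have h₃ := ιFRight_tensorComparison_whiskerLeft F K L M i (j + l) n (by lia)
  have h₄ : F.map (ιTensorObj K L i j a ha) ▷ F.obj (M.X l) ≫ μ F ((K ⊗ L).X a) (M.X l) =
      μ F (K.X i ⊗ L.X j) (M.X l) ≫ F.map (ιTensorObj K L i j a ha ▷ M.X l) :=
    μ_natural_left F _ _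
  have h₅ : F.obj (K.X i) ◁ F.map (ιTensorObj L M j l (j + l) rfl) ≫
      μ F (K.X i) ((L ⊗ M).X (j + l)) =
        μ F (K.X i) (L.X j ⊗ M.X l) ≫ F.map (K.X i ◁ ιTensorObj L M j l (j + l) rfl) :=
    μ_natural_right F _ _
  rw [reassoc_of% h₁, reassoc_of% h₂, reassoc_of% h₃, ιF_tensorComparisonX_assoc,
    ιF_tensorComparisonX, ← comp_whiskerRight_assoc, ← whiskerLeft_comp_assoc,
    ιF_tensorComparisonX, ιF_tensorComparisonX, comp_whiskerRight_assoc, whiskerLeft_comp_assoc,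
    reassoc_of% h₄, reassoc_of% h₅, ← F.map_comp, ← F.map_comp, ← F.map_comp,
    ι_associator_hom K L M i j l n a (j + l) ha han rfl (by lia), F.map_comp,
    associativity_assoc]

/-- The image of the unit complex. -/
noncomputable def unitComparison :
    𝟙_ (CochainComplex A' ℤ) ≅ (mapC F).obj (𝟙_ (CochainComplex A ℤ)) :=
  (single A' (.up ℤ) 0).mapIso (Functor.Monoidal.εIso F) ≪≫
    ((singleMapHomologicalComplex F (.up ℤ) 0).app (𝟙_ A)).symm

/-- The degree zero part of `unitComparison`. -/
noncomputable def unitComparisonX :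
    (𝟙_ (CochainComplex A' ℤ)).X 0 ⟶ F.obj ((𝟙_ (CochainComplex A ℤ)).X 0) :=
  (unitComparison F).hom.f 0

lemma unitX_unitComparisonX :
    unitX A' ≫ unitComparisonX F = ε F ≫ F.map (unitX A) := by
  refine (?_ : (singleObjXSelf (.up ℤ) 0 (𝟙_ A')).inv ≫
    ((single A' (.up ℤ) 0).map (ε F)).f 0 ≫
      ((singleMapHomologicalComplex F (.up ℤ) 0).inv.app (𝟙_ A)).f 0 = _)
  rw [singleMapHomologicalComplex_inv_app_self, single_map_f_self]
  refine (?_ : (singleObjXSelf (.up ℤ) 0 (𝟙_ A')).inv ≫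
    ((singleObjXSelf (.up ℤ) 0 (𝟙_ A')).hom ≫ ε F ≫
      (singleObjXSelf (.up ℤ) 0 (F.obj (𝟙_ A))).inv) ≫
        (singleObjXSelf (.up ℤ) 0 (F.obj (𝟙_ A))).hom ≫ F.map (unitX A) = _)
  simp

/-- Only the summand `(0, n)` is met, and there the identity is left unitality of `F` at `K.X n`. -/
lemma tensorComparison_left_unitality_f (K : CochainComplex A ℤ) (n : ℤ) :
    (λ_ ((mapC F).obj K)).inv.f n ≫ ((unitComparison F).hom ▷ (mapC F).obj K).f n ≫
      tensorComparisonX F (𝟙_ _) K n = F.map ((λ_ K).inv.f n) := by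
  have h₁ := ι_whiskerRight (unitComparison F).hom ((mapC F).obj K) 0 n n (zero_add n)
  rw [leftUnitor_inv_f, leftUnitor_inv_f, Category.assoc, Category.assoc, reassoc_of% h₁]
  have h₂ := ιF_tensorComparisonX F (𝟙_ _) K 0 n n (zero_add n)
  refine (?_ : (λ_ (F.obj (K.X n))).inv ≫ (unitX A' ▷
    F.obj (K.X n)) ≫ (unitComparisonX F ▷ F.obj (K.X n)) ≫
      ιF F (𝟙_ _) K 0 n n (zero_add n) ≫ tensorComparisonX F (𝟙_ _) K n = _)
  rw [h₂, ← comp_whiskerRight_assoc, unitX_unitComparisonX, comp_whiskerRight_assoc,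
    F.map_comp, F.map_comp]
  have h₃ : F.map (unitX A) ▷ F.obj (K.X n) ≫
      μ F ((𝟙_ (CochainComplex A ℤ)).X 0) (K.X n) =
        μ F (𝟙_ A) (K.X n) ≫ F.map (unitX A ▷ K.X n) := μ_natural_left F _ _
  rw [reassoc_of% h₃, left_unitality_inv_assoc]

lemma tensorComparison_right_unitality_f (K : CochainComplex A ℤ) (n : ℤ) :
    (ρ_ ((mapC F).obj K)).inv.f n ≫ ((mapC F).obj K ◁ (unitComparison F).hom).f n ≫
      tensorComparisonX F K (𝟙_ _) n = F.map ((ρ_ K).inv.f n) := by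
  have h₁ := ι_whiskerLeft (unitComparison F).hom ((mapC F).obj K) n 0 n (add_zero n)
  rw [rightUnitor_inv_f, rightUnitor_inv_f, Category.assoc, Category.assoc, reassoc_of% h₁]
  have h₂ := ιF_tensorComparisonX F K (𝟙_ _) n 0 n (add_zero n)
  refine (?_ : (ρ_ (F.obj (K.X n))).inv ≫ (F.obj (K.X n) ◁
    unitX A') ≫ (F.obj (K.X n) ◁ unitComparisonX F) ≫
      ιF F K (𝟙_ _) n 0 n (add_zero n) ≫ tensorComparisonX F K (𝟙_ _) n = _)
  rw [h₂, ← whiskerLeft_comp_assoc, unitX_unitComparisonX, whiskerLeft_comp_assoc,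
    F.map_comp, F.map_comp]
  have h₃ : F.obj (K.X n) ◁ F.map (unitX A) ≫
      μ F (K.X n) ((𝟙_ (CochainComplex A ℤ)).X 0) =
        μ F (K.X n) (𝟙_ A) ≫ F.map (K.X n ◁ unitX A) := μ_natural_right F _ _
  rw [reassoc_of% h₃, right_unitality_inv_assoc]

/-- A monoidal functor induces a monoidal functor between categories of complexes. -/
noncomputable def mapCCoreMonoidal : (mapC F).CoreMonoidal where
  εIso := unitComparison F
  μIso := tensorComparison F
  μIso_hom_natural_left f L := tensorComparison_whiskerRight F f L
  μIso_hom_natural_right L f := tensorComparison_whiskerLeft F f L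
  associativity K L M :=
    HomologicalComplex.hom_ext _ _ (fun n ↦ tensorComparison_associativity_f F K L M n)
  left_unitality K := by
    have h : (λ_ ((mapC F).obj K)).inv ≫ (unitComparison F).hom ▷ (mapC F).obj K ≫
        (tensorComparison F (𝟙_ _) K).hom = (mapC F).map (λ_ K).inv :=
      HomologicalComplex.hom_ext _ _ (fun n ↦ tensorComparison_left_unitality_f F K n)
    -- The identity was verified for inverse unitors; cancelling the isomorphism gives the required
    -- form.
    rw [← cancel_epi (λ_ ((mapC F).obj K)).inv, Iso.inv_hom_id, reassoc_of% h,
      ← Functor.map_comp, Iso.inv_hom_id, CategoryTheory.Functor.map_id]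
  right_unitality K := by
    have h : (ρ_ ((mapC F).obj K)).inv ≫ (mapC F).obj K ◁ (unitComparison F).hom ≫
        (tensorComparison F K (𝟙_ _)).hom = (mapC F).map (ρ_ K).inv :=
      HomologicalComplex.hom_ext _ _ (fun n ↦ tensorComparison_right_unitality_f F K n)
    rw [← cancel_epi (ρ_ ((mapC F).obj K)).inv, Iso.inv_hom_id, reassoc_of% h,
      ← Functor.map_comp, Iso.inv_hom_id, CategoryTheory.Functor.map_id]

end Monoidal

end BoundedDerived

/-! ### Monoidal functors between bounded derived categories -/

namespace BoundedDerived

section Monoidal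

variable {A : Type*} [Category* A] [Abelian A] [MonoidalCategory A] [MonoidalPreadditive A]
  [HasColimitsOfSize.{0, 0} A]
  [∀ X : A, PreservesColimitsOfSize.{0, 0} ((curriedTensor A).obj X)]
  [∀ X : A, PreservesColimitsOfSize.{0, 0} ((curriedTensor A).flip.obj X)]
  {A' : Type*} [Category* A'] [Abelian A'] [MonoidalCategory A'] [MonoidalPreadditive A']
  [HasColimitsOfSize.{0, 0} A']
  [∀ X : A', PreservesColimitsOfSize.{0, 0} ((curriedTensor A').obj X)]
  [∀ X : A', PreservesColimitsOfSize.{0, 0} ((curriedTensor A').flip.obj X)]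
  {P : ObjectProperty A} [P.IsClosedUnderQuotients] [P.IsClosedUnderFiniteProducts]
  [P.IsMonoidal]
  (P' : ObjectProperty A') [P'.IsClosedUnderQuotients] [P'.IsClosedUnderFiniteProducts]
  [P'.IsMonoidal]
  (F : A ⥤ A') [F.Monoidal] [F.Additive] [PreservesColimitsOfSize.{0, 0} F]
  (hF : P ≤ P'.inverseImage F)

/-- A monoidal functor induces a monoidal functor between categories of bounded complexes. -/
noncomputable def mapCbCoreMonoidal : (mapCb P' F hF).CoreMonoidal where
  εIso := (bounded P').isoMk (unitComparison F)
  μIso K L := (bounded P').isoMk (tensorComparison F K.obj L.obj)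
  μIso_hom_natural_left f L := by
    ext1
    exact tensorComparison_whiskerRight F f.hom L.obj
  μIso_hom_natural_right L f := by
    ext1
    exact tensorComparison_whiskerLeft F f.hom L.obj
  associativity K L M := by
    ext1
    exact (mapCCoreMonoidal F).associativity K.obj L.obj M.obj
  left_unitality K := by
    ext1
    exact (mapCCoreMonoidal F).left_unitality K.obj
  right_unitality K := by
    ext1
    exact (mapCCoreMonoidal F).right_unitality K.obj

noncomputable instance : (mapCb P' F hF).Monoidal := (mapCbCoreMonoidal P' F hF).toMonoidal

variable [(quasiIso P).IsMonoidal] [(quasiIso P').IsMonoidal]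

/-- Universal property of monoidal localization: `mapDb` lifts the monoidal functor `mapCb ⋙ Q`. -/
noncomputable instance [PreservesFiniteLimits F] [PreservesFiniteColimits F] :
    (mapDb P' F hF).Monoidal :=
  Localization.Monoidal.functorMonoidalOfComp (Q P) (quasiIso P) (mapDb P' F hF)
    (mapCb P' F hF ⋙ Q P')

lemma isTTFunctor_mapDb (k : Type*) [Field k] [CategoryTheory.Linear k A]
    [CategoryTheory.Linear k A'] [F.Linear k]
    [PreservesFiniteLimits F] [PreservesFiniteColimits F] :
    TensorTriangulated.IsTTFunctor k (mapDb P' F hF) where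
  additive := inferInstance
  linear := inferInstance
  exact := ⟨inferInstance, inferInstance⟩
  monoidal := ⟨inferInstance⟩

end Monoidal

end BoundedDerived

open BoundedDerived TensorTriangulated

/-! ### The functors at the vertices are points -/

namespace QuiverRep

variable {k : Type u} [Field k] {V : Type v} [Quiver.{w} V] (R : Relations k V) [R.IsTensor]
  (Vect : ObjectProperty (ModuleCat.{u} k)) [Vect.IsClosedUnderQuotients]
  [Vect.IsClosedUnderFiniteProducts] [Vect.IsMonoidal]

instance (n : V) : (vertex (k := k) n).Linear k where

lemma finRep_le (n : V) : finRep R ≤ Vect.inverseImage (vertex n) :=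
  fun _ hM ↦ isFG_le k Vect _ (hM.1 n)

lemma isTTFunctor_vertexFunctor (n : V) : IsTTFunctor k (vertexFunctor R Vect n) :=
  isTTFunctor_mapDb Vect (vertex n) (finRep_le R Vect n) k

end QuiverRep

/-! ### Kernels of tensor triangulated functors and prime ideals -/

namespace TensorTriangulated

lemma isZero_of_retract {C : Type*} [Category* C] [HasZeroMorphisms C] {X Y : C}
    (r : Retract X Y) (h : IsZero Y) : IsZero X := by
  rw [IsZero.iff_id_eq_zero, ← r.retract, h.eq_of_tgt r.i 0, zero_comp]

section Functors

variable {k : Type*} [Field k]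
  {T : Type*} [Category* T] [Preadditive T] [HasZeroObject T] [HasShift T ℤ]
  [∀ n : ℤ, (shiftFunctor T n).Additive] [Pretriangulated T] [CategoryTheory.Linear k T]
  [MonoidalCategory T]
  {S : Type*} [Category* S] [Preadditive S] [HasZeroObject S] [HasShift S ℤ]
  [∀ n : ℤ, (shiftFunctor S n).Additive] [Pretriangulated S] [CategoryTheory.Linear k S]
  [MonoidalCategory S]

lemma isZero_of_distTriang {X Y Z : S} {f : X ⟶ Y} {g : Y ⟶ Z} {h : Z ⟶ X⟦(1 : ℤ)⟧}
    (hT : Triangle.mk f g h ∈ distTriang S) (hX : IsZero X) (hZ : IsZero Z) : IsZero Y := by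
  have : IsIso f := ((Triangle.mk f g h).isZero₃_iff_isIso₁ hT).1 hZ
  exact hX.of_iso (asIso f).symm

instance : ObjectProperty.IsClosedUnderIsomorphisms (C := S) IsZero where
  of_iso e h := h.of_iso e.symm

instance : ObjectProperty.IsTriangulated (C := S) IsZero where
  isStableUnderShiftBy n := { le_shift _ hX := (shiftFunctor S n).map_isZero hX }
  toIsTriangulatedClosed₂ := .mk' (fun _ hT h₁ h₃ ↦
    isZero_of_distTriang hT h₁ h₃)

/-- The objects sent to zero by a functor. -/
def functorKernel (F : T ⥤ S) : ObjectProperty T :=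
  ObjectProperty.inverseImage IsZero F

lemma Points.mk_eq_iff {F G : T ⥤ S} (hF : IsTTFunctor k F) (hG : IsTTFunctor k G) :
    Points.mk k F hF = Points.mk k G hG ↔ Nonempty (F ≅ G) := by
  refine Quotient.eq.trans ⟨fun ⟨e⟩ ↦ ⟨(ObjectProperty.ι _).mapIso e⟩,
    fun ⟨e⟩ ↦ ⟨ObjectProperty.isoMk _ e⟩⟩

lemma IsTTFunctor.isZero_tensor_iff {F : T ⥤ S} (hF : IsTTFunctor k F)
    (hS : ∀ X Y : S, IsZero (X ⊗ Y) ↔ IsZero X ∨ IsZero Y) (X Y : T) :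
    IsZero (F.obj (X ⊗ Y)) ↔ IsZero (F.obj X) ∨ IsZero (F.obj Y) := by
  obtain ⟨_⟩ := hF.monoidal
  rw [← hS]
  exact (Functor.Monoidal.μIso F X Y).symm.isZero_iff

/-- Under `hS` and `h₁` the zero objects of `S` form a prime ideal, and primes pull back along
tensor functors. -/
lemma IsTTFunctor.isPrime_kernel {F : T ⥤ S} (hF : IsTTFunctor k F)
    (hS : ∀ X Y : S, IsZero (X ⊗ Y) ↔ IsZero X ∨ IsZero Y) (h₁ : ¬ IsZero (𝟙_ S)) :
    IsPrime (functorKernel F) where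
  isTriangulated := by
    obtain ⟨_, _⟩ := hF.exact
    exact inferInstanceAs (ObjectProperty.inverseImage (D := S) IsZero F).IsTriangulated
  isStableUnderRetracts :=
    { of_retract r h := isZero_of_retract (r.map F) h }
  tensor_mem X Y hX := (hF.isZero_tensor_iff hS X Y).2 (Or.inl hX)
  proper := by
    obtain ⟨_⟩ := hF.monoidal
    exact ⟨𝟙_ T, fun h ↦ h₁ (h.of_iso (Functor.Monoidal.εIso F))⟩
  mem_or_mem X Y h := (hF.isZero_tensor_iff hS X Y).1 h

lemma IsTTFunctor.mem_kernel_of_isIso {F : T ⥤ S} (hF : IsTTFunctor k F) {X Y Z : T}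
    {f : X ⟶ Y} {g : Y ⟶ Z} {h : Z ⟶ X⟦(1 : ℤ)⟧} (hT : Triangle.mk f g h ∈ distTriang T) :
    functorKernel F Z ↔ IsIso (F.map f) := by
  obtain ⟨_, _⟩ := hF.exact
  exact (F.mapTriangle.obj (Triangle.mk f g h)).isZero₃_iff_isIso₁ (F.map_distinguished _ hT)

/-- The cone of `f` is killed by `F`, hence by `F'`. -/
lemma IsTTFunctor.isIso_of_kernel_le {F F' : T ⥤ S} (hF : IsTTFunctor k F)
    (hF' : IsTTFunctor k F') (h : functorKernel F ≤ functorKernel F') {X Y : T} (f : X ⟶ Y)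
    [hf : IsIso (F.map f)] : IsIso (F'.map f) := by
  obtain ⟨Z, g, h', hT⟩ := distinguished_cocone_triangle f
  exact (hF'.mem_kernel_of_isIso hT).1 (h _ ((hF.mem_kernel_of_isIso hT).2 hf))

namespace IsPrime

variable {P : ObjectProperty T} (hP : IsPrime P)

include hP

/-- The cone of `f` lies in `ker F`, hence in `P`, and `P` satisfies two out of three on triangles.
-/
lemma mem_iff_of_isIso {F : T ⥤ S} (hF : IsTTFunctor k F) (h : functorKernel F ≤ P) {X Y : T}
    (f : X ⟶ Y) [hf : IsIso (F.map f)] : P X ↔ P Y := by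
  have := hP.isTriangulated
  have := hP.isStableUnderRetracts
  obtain ⟨Z, g, h', hT⟩ := distinguished_cocone_triangle f
  have hZ := h _ ((hF.mem_kernel_of_isIso hT).2 hf)
  exact ⟨fun hX ↦ P.ext_of_isTriangulatedClosed₂ _ hT hX hZ,
    fun hY ↦ P.ext_of_isTriangulatedClosed₁ _ hT hY hZ⟩

lemma not_mem_unit : ¬ P (𝟙_ T) := fun h ↦ by
  have := hP.isStableUnderRetracts
  obtain ⟨X, hX⟩ := hP.proper
  exact hX (P.prop_of_iso (λ_ X) (hP.tensor_mem _ X h))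

/-- Prime avoidance: if no kernel were contained in `P`, tensoring one witness `B i` from each
kernel would give an object outside `P` killed by every `F i`, that is, a zero object. -/
lemma exists_kernel_le {ι : Type*} [Finite ι] (F : ι → T ⥤ S) (hF : ∀ i, IsTTFunctor k (F i))
    (hS : ∀ X Y : S, IsZero (X ⊗ Y) ↔ IsZero X ∨ IsZero Y)
    (h : ∀ X, (∀ i, functorKernel (F i) X) → IsZero X) : ∃ i, functorKernel (F i) ≤ P := by
  have := hP.isStableUnderRetracts
  have := hP.isTriangulated
  by_contra! H
  choose B hB hB' using H
  classical
  have := Fintype.ofFinite ι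
  -- The tensor product of the witnesses over `s`, starting from the unit.
  have (s : Finset ι) : ∃ X, ¬ P X ∧ ∀ i ∈ s, functorKernel (F i) X := by
    induction s using Finset.induction_on with
    | empty => exact ⟨_, hP.not_mem_unit, by simp⟩
    | insert i s _ hs =>
      obtain ⟨X, hX, hX'⟩ := hs
      refine ⟨X ⊗ B i, fun h ↦ (hP.mem_or_mem _ _ h).elim hX (hB' i), fun j hj ↦ ?_⟩
      rw [functorKernel, ObjectProperty.prop_inverseImage_iff, (hF j).isZero_tensor_iff hS]
      rcases Finset.mem_insert.1 hj with rfl | hj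
      · exact Or.inr (hB j)
      · exact Or.inl (hX' j hj)
  obtain ⟨X, hX, hX'⟩ := this Finset.univ
  exact hX (P.prop_of_isZero (h X (fun i ↦ hX' i (Finset.mem_univ i))))

end IsPrime

end Functors

end TensorTriangulated

/-! ### Extending an isomorphism of linear functors from direct summands -/

section Extension

variable {k : Type*} [Field k] {C : Type*} [Category* C] [Preadditive C]
  [CategoryTheory.Linear k C] {E : Type*} [Category* E] [Preadditive E]
  [CategoryTheory.Linear k E] (G J : C ⥤ E) [G.Additive] [J.Additive] [G.Linear k] [J.Linear k]

/-- Two linear functors are isomorphic if they agree on a family of pairwise orthogonal objects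
with only scalar endomorphisms, and every object is a finite direct sum of such objects. -/
lemma nonempty_iso_of_decomposition {I : Type*} (S : I → C)
    (hS : ∀ i j (f : S i ⟶ S j), i ≠ j → f = 0)
    (hS' : ∀ i (f : S i ⟶ S i), ∃ c : k, f = c • 𝟙 _)
    (hC : ∀ X : C, ∃ (A : Type) (_ : Fintype A) (i : A → I) (p : ∀ a, X ⟶ S (i a))
      (q : ∀ a, S (i a) ⟶ X), ∑ a, p a ≫ q a = 𝟙 X)
    (φ : ∀ i, G.obj (S i) ≅ J.obj (S i)) : Nonempty (G ≅ J) := by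
  -- Only `∑ p ≫ q = 𝟙` is available, which exhibits `X` as a retract of a sum; orthogonality of the
  -- projections and inclusions is never needed.
  choose A _ i p q hpq using hC
  -- Arbitrarily chosen isomorphisms are automatically natural on the `S i`, because the maps
  -- between these are zero or scalars.
  have hφ {a b : I} (f : S a ⟶ S b) : G.map f ≫ (φ b).hom = (φ a).hom ≫ J.map f := by
    by_cases h : a = b
    · subst h
      obtain ⟨c, rfl⟩ := hS' a f
      simp [Functor.map_smul]
    · simp [hS a b f h]
  -- Transport `φ` through the chosen decompositions. Naturality in `f` reduces to its matrix
  -- entries `q ≫ f ≫ p`, which are maps between the `S i`.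
  let η : G ⟶ J :=
    { app X := ∑ a, G.map (p X a) ≫ (φ (i X a)).hom ≫ J.map (q X a)
      naturality X Y f := by
        have h₁ : G.map f = ∑ a, G.map (p X a) ≫ G.map (q X a ≫ f) := by
          simp only [← Functor.map_comp, ← Category.assoc, ← Functor.map_sum]
          rw [← Preadditive.sum_comp, hpq, Category.id_comp]
        have h₂ : J.map f = ∑ b, J.map (f ≫ p Y b) ≫ J.map (q Y b) := by
          simp only [← Functor.map_comp, Category.assoc, ← Functor.map_sum]
          rw [← Preadditive.comp_sum, hpq, Category.comp_id]
        rw [h₁, Preadditive.sum_comp, h₂, Preadditive.sum_comp]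
        refine Finset.sum_congr rfl (fun a _ ↦ ?_)
        rw [Preadditive.comp_sum, Preadditive.comp_sum]
        refine Finset.sum_congr rfl (fun b _ ↦ ?_)
        have := hφ (q X a ≫ f ≫ p Y b)
        simp only [Functor.map_comp, Category.assoc] at this ⊢
        rw [reassoc_of% this] }
  -- The decomposition chosen for `S j` need not be the trivial one, so this has to be checked.
  have hη (j : I) : η.app (S j) = (φ j).hom := by
    have (a : A (S j)) : G.map (p (S j) a) ≫ (φ (i (S j) a)).hom ≫ J.map (q (S j) a) =
        (φ j).hom ≫ J.map (p (S j) a ≫ q (S j) a) := by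
      rw [← Category.assoc, hφ, Category.assoc, ← J.map_comp]
    change ∑ a, _ = _
    rw [Finset.sum_congr rfl (fun a _ ↦ this a), ← Preadditive.comp_sum, ← Functor.map_sum,
      hpq, J.map_id, Category.comp_id]
  have (X : C) : IsIso (η.app X) := by
    refine ⟨∑ a, J.map (p X a) ≫ (φ (i X a)).inv ≫ G.map (q X a), ?_, ?_⟩
    · have (a : A X) : η.app X ≫ J.map (p X a) ≫ (φ (i X a)).inv ≫ G.map (q X a) =
          G.map (p X a ≫ q X a) := by
        rw [← NatTrans.naturality_assoc, hη, Iso.hom_inv_id_assoc, G.map_comp]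
      rw [Preadditive.comp_sum, Finset.sum_congr rfl (fun a _ ↦ this a), ← Functor.map_sum, hpq,
        G.map_id]
    · have (a : A X) : (J.map (p X a) ≫ (φ (i X a)).inv ≫ G.map (q X a)) ≫ η.app X =
          J.map (p X a ≫ q X a) := by
        rw [Category.assoc, Category.assoc, NatTrans.naturality, hη, Iso.inv_hom_id_assoc,
          J.map_comp]
      rw [Preadditive.sum_comp, Finset.sum_congr rfl (fun a _ ↦ this a), ← Functor.map_sum, hpq,
        J.map_id]
  exact ⟨NatIso.ofComponents (fun X ↦ asIso (η.app X)) (fun f ↦ η.naturality f)⟩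

end Extension

/-! ### Vanishing of tensor products in `Dᵇ` -/

namespace BoundedDerived

section Monoidal

variable {A : Type*} [Category* A] [Abelian A] [MonoidalCategory A] [MonoidalPreadditive A]
  [HasColimitsOfSize.{0, 0} A]
  [∀ X : A, PreservesColimitsOfSize.{0, 0} ((curriedTensor A).obj X)]
  [∀ X : A, PreservesColimitsOfSize.{0, 0} ((curriedTensor A).flip.obj X)]
  {P : ObjectProperty A} [P.IsClosedUnderQuotients] [P.IsClosedUnderFiniteProducts]
  [P.IsMonoidal]

lemma zero_whiskerRight_Cb (K K' L : Cb P) : (0 : K ⟶ K') ▷ L = 0 := by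
  ext1
  refine HomologicalComplex.hom_ext _ _ (fun n ↦ tensor_hom_ext _ _ (fun i j hij ↦ ?_))
  refine (ι_whiskerRight (0 : K.obj ⟶ K'.obj) L.obj i j n hij).trans ?_
  rw [HomologicalComplex.zero_f, MonoidalPreadditive.zero_whiskerRight, zero_comp]
  exact comp_zero.symm

lemma whiskerLeft_zero_Cb (L K K' : Cb P) : L ◁ (0 : K ⟶ K') = 0 := by
  ext1
  refine HomologicalComplex.hom_ext _ _ (fun n ↦ tensor_hom_ext _ _ (fun i j hij ↦ ?_))
  refine (ι_whiskerLeft (0 : K.obj ⟶ K'.obj) L.obj i j n hij).trans ?_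
  rw [HomologicalComplex.zero_f, MonoidalPreadditive.whiskerLeft_zero, zero_comp]
  exact comp_zero.symm

variable [(quasiIso P).IsMonoidal]

open Functor.LaxMonoidal Functor.OplaxMonoidal

/-- For complexes `K`, `L` representing `X`, `Y`, the identity of `X` is the image of `0 : K ⟶ K`,
so that of `X ⊗ Y` is the image of `0 ▷ L = 0`. -/
lemma isZero_tensor_Db_left {X : Db P} (hX : IsZero X) (Y : Db P) : IsZero (X ⊗ Y) := by
  let K := (Q P).objPreimage X
  let eX : (Q P).obj K ≅ X := (Q P).objObjPreimageIso X
  let L := (Q P).objPreimage Y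
  let eY : (Q P).obj L ≅ Y := (Q P).objObjPreimageIso Y
  refine IsZero.of_iso ?_ (eX ⊗ᵢ eY).symm
  refine IsZero.of_iso ?_ (Functor.Monoidal.μIso (Q P) K L)
  have h : (Q P).map (0 : K ⟶ K) = 𝟙 _ := (hX.of_iso eX).eq_of_src _ _
  rw [IsZero.iff_id_eq_zero, ← cancel_epi (μ (Q P) K L), Category.comp_id, comp_zero]
  have := μ_natural_left (Q P) (0 : K ⟶ K) L
  rw [h, id_whiskerRight, Category.id_comp, zero_whiskerRight_Cb, Functor.map_zero,
    comp_zero] at this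
  exact this

lemma isZero_tensor_Db_right (X : Db P) {Y : Db P} (hY : IsZero Y) : IsZero (X ⊗ Y) := by
  let K := (Q P).objPreimage X
  let eX : (Q P).obj K ≅ X := (Q P).objObjPreimageIso X
  let L := (Q P).objPreimage Y
  let eY : (Q P).obj L ≅ Y := (Q P).objObjPreimageIso Y
  refine IsZero.of_iso ?_ (eX ⊗ᵢ eY).symm
  refine IsZero.of_iso ?_ (Functor.Monoidal.μIso (Q P) K L)
  have h : (Q P).map (0 : L ⟶ L) = 𝟙 _ := (hY.of_iso eY).eq_of_src _ _
  rw [IsZero.iff_id_eq_zero, ← cancel_epi (μ (Q P) K L), Category.comp_id, comp_zero]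
  have := μ_natural_right (Q P) K (0 : L ⟶ L)
  rw [h, whiskerLeft_id, Category.id_comp, whiskerLeft_zero_Cb, Functor.map_zero,
    comp_zero] at this
  exact this

end Monoidal

section VectorSpaces

variable {k : Type u} [Field k]

lemma exists_dual_of_notMem {M : Type*} [AddCommGroup M] [Module k M] {p : Submodule k M}
    {x : M} (hx : x ∉ p) : ∃ f : M →ₗ[k] k, f x = 1 ∧ ∀ y ∈ p, f y = 0 := by
  obtain ⟨f, hf, hp⟩ := Submodule.exists_dual_map_eq_bot_of_notMem hx inferInstance
  refine ⟨(f x)⁻¹ • f, by simp [hf], fun y hy ↦ ?_⟩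
  have : f y ∈ p.map f := ⟨y, hy, rfl⟩
  rw [hp, Submodule.mem_bot] at this
  simp [this]

variable (k) in
/-- The unit vector space, in degree `i`. -/
noncomputable abbrev unitSingle (i : ℤ) : CochainComplex (ModuleCat.{u} k) ℤ :=
  (HomologicalComplex.single _ (.up ℤ) i).obj (𝟙_ (ModuleCat.{u} k))

/-- A complex of vector spaces with nonzero `i`-th cohomology has a direct summand `k[-i]`. -/
lemma nonempty_retract_unitSingle (K : CochainComplex (ModuleCat.{u} k) ℤ) (i : ℤ)
    (h : ¬ IsZero (K.homology i)) : Nonempty (Retract (unitSingle k i) K) := by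
  rw [← HomologicalComplex.exactAt_iff_isZero_homology,
    HomologicalComplex.exactAt_iff' K (i - 1) i (i + 1) (by simp) (by simp),
    ShortComplex.moduleCat_exact_iff] at h
  push Not at h
  obtain ⟨x, hx, hx'⟩ := h
  -- The cocycle `x` gives a chain map `k[-i] ⟶ K`. A functional that kills coboundaries and takes
  -- the value `1` at `x` gives a retraction.
  obtain ⟨f, hf, hf'⟩ := exists_dual_of_notMem (k := k) (x := x)
    (p := LinearMap.range (K.d (i - 1) i).hom) (by rintro ⟨y, hy⟩; exact hx' y hy)
  let a : 𝟙_ (ModuleCat.{u} k) ⟶ K.X i := ModuleCat.ofHom (LinearMap.toSpanSingleton k (K.X i) x)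
  let b : K.X i ⟶ 𝟙_ (ModuleCat.{u} k) := ModuleCat.ofHom f
  refine ⟨⟨HomologicalComplex.mkHomFromSingle a (fun j hj ↦ ?_),
    HomologicalComplex.mkHomToSingle b (fun j hj ↦ ?_), ?_⟩⟩
  · obtain rfl : i + 1 = j := hj
    ext
    change K.d i (i + 1) ((1 : k) • x) = 0
    rw [one_smul]
    exact hx
  · obtain rfl : j = i - 1 := by have : j + 1 = i := hj; lia
    ext y
    exact hf' _ ⟨y, rfl⟩
  · refine HomologicalComplex.from_single_hom_ext ?_
    have hab : a ≫ b = 𝟙 _ := by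
      ext
      change f ((1 : k) • x) = 1
      rw [one_smul, hf]
    simp [reassoc_of% hab]

lemma not_isZero_unit : ¬ IsZero (𝟙_ (ModuleCat.{u} k)) := fun h ↦ by
  have : Subsingleton k := ModuleCat.subsingleton_of_isZero h
  exact zero_ne_one (Subsingleton.elim (0 : k) 1)

lemma unitSingle_hom_eq_zero {i j : ℤ} (hij : i ≠ j) (f : unitSingle k i ⟶ unitSingle k j) :
    f = 0 :=
  HomologicalComplex.from_single_hom_ext
    ((HomologicalComplex.isZero_single_obj_X (.up ℤ) j _ i hij).eq_of_tgt _ _)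

lemma unitSingle_hom_eq_smul {i : ℤ} (f : unitSingle k i ⟶ unitSingle k i) :
    ∃ c : k, f = c • 𝟙 _ := by
  obtain ⟨g, rfl⟩ := (HomologicalComplex.single _ (.up ℤ) i).map_surjective f
  refine ⟨g.hom (1 : k), ?_⟩
  have hg : g = (g.hom (1 : k)) • 𝟙 _ := by
    ext
    exact (mul_one (M := k) _).symm
  refine HomologicalComplex.from_single_hom_ext ?_
  rw [HomologicalComplex.single_map_f_self, HomologicalComplex.smul_f_apply,
    HomologicalComplex.id_f]
  conv_lhs => rw [hg]
  simp

/-- The product is concentrated in degree `i + j`, so exactness there would make this term zero; but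
the term has `k ⊗ k` as a retract. -/
lemma not_isZero_homology_tensor (i j : ℤ) :
    ¬ IsZero ((unitSingle k i ⊗ unitSingle k j).homology (i + j)) := by
  intro h
  have hX (n : ℤ) (hn : n ≠ i + j) : IsZero ((unitSingle k i ⊗ unitSingle k j).X n) := by
    rw [IsZero.iff_id_eq_zero]
    refine tensor_hom_ext _ _ (fun a b hab ↦ IsZero.eq_of_src ?_ _ _)
    by_cases ha : a = i
    · exact isZero_tensor_right (HomologicalComplex.isZero_single_obj_X _ _ _ _ (by lia))
    · exact isZero_tensor_left (HomologicalComplex.isZero_single_obj_X _ _ _ _ ha)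
  rw [← HomologicalComplex.exactAt_iff_isZero_homology,
    HomologicalComplex.exactAt_iff' _ (i + j - 1) (i + j) (i + j + 1) (by simp) (by simp)] at h
  have h₀ : IsZero ((unitSingle k i ⊗ unitSingle k j).X (i + j)) := h.isZero_X₂
    ((hX _ (by lia)).eq_of_src _ _) ((hX _ (by lia)).eq_of_tgt _ _)
  let e (l a : ℤ) (h : a = l) := (HomologicalComplex.singleObjXIsoOfEq (.up ℤ) l
    (𝟙_ (ModuleCat.{u} k)) a h)
  -- The projection to the summand `(i, j)`, zero on all other summands.
  let g : (unitSingle k i ⊗ unitSingle k j).X (i + j) ⟶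
      𝟙_ (ModuleCat.{u} k) ⊗ 𝟙_ (ModuleCat.{u} k) :=
    HomologicalComplex.mapBifunctorDesc (fun a b hab ↦
      if ha : a = i then (e i a ha).hom ⊗ₘ (e j b (by have : a + b = i + j := hab; lia)).hom
      else 0)
  have hg : HomologicalComplex.ιTensorObj (unitSingle k i) (unitSingle k j) i j (i + j) rfl ≫ g =
      (e i i rfl).hom ⊗ₘ (e j j rfl).hom :=
    (HomologicalComplex.ι_mapBifunctorDesc _ _ _ _).trans (dif_pos rfl)
  have : IsIso ((e i i rfl).hom ⊗ₘ (e j j rfl).hom) := inferInstance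
  rw [← hg, h₀.eq_of_src g 0, comp_zero, isIsoZero_iff_source_target_isZero] at this
  exact not_isZero_unit (this.2.of_iso (λ_ (𝟙_ (ModuleCat.{u} k))).symm)

variable (P : ObjectProperty (ModuleCat.{u} k)) [P.IsClosedUnderQuotients]
  [P.IsClosedUnderFiniteProducts] [P.IsMonoidal]

lemma not_isZero_unit_Db : ¬ IsZero (𝟙_ (Db P)) := by
  intro h
  have h' : IsZero ((Q P).obj (𝟙_ (Cb P))) := h.of_iso (Functor.Monoidal.εIso (Q P)).symm
  rw [isZero_Q_iff] at h'
  exact not_isZero_unit ((h' 0).of_iso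
    (HomologicalComplex.singleObjHomologySelfIso (.up ℤ) 0 (𝟙_ (ModuleCat.{u} k))).symm)

/-- In place of a Künneth formula: if `Hⁱ(K)` and `Hʲ(L)` are nonzero, then `k[-i] ⊗ k[-j]` is a
retract of `K ⊗ L` with nonzero cohomology in degree `i + j`. -/
lemma isZero_tensor_Db_iff (X Y : Db P) : IsZero (X ⊗ Y) ↔ IsZero X ∨ IsZero Y := by
  refine ⟨fun h ↦ ?_, fun h ↦ h.elim (isZero_tensor_Db_left · Y) (isZero_tensor_Db_right X)⟩
  let K := (Q P).objPreimage X
  let eX : (Q P).obj K ≅ X := (Q P).objObjPreimageIso X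
  let L := (Q P).objPreimage Y
  let eY : (Q P).obj L ≅ Y := (Q P).objObjPreimageIso Y
  have h₁ := (h.of_iso (eX ⊗ᵢ eY)).of_iso (Functor.Monoidal.μIso (Q P) K L).symm
  rw [isZero_Q_iff] at h₁
  rw [← eX.isZero_iff, ← eY.isZero_iff, isZero_Q_iff, isZero_Q_iff]
  by_contra! H
  obtain ⟨⟨i, hi⟩, ⟨j, hj⟩⟩ := H
  obtain ⟨r⟩ := nonempty_retract_unitSingle _ i hi
  obtain ⟨r'⟩ := nonempty_retract_unitSingle _ j hj
  let ρ : Retract (unitSingle k i ⊗ unitSingle k j) (K.obj ⊗ L.obj) :=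
    { i := r.i ⊗ₘ r'.i
      r := r.r ⊗ₘ r'.r
      retract := by simp }
  exact not_isZero_homology_tensor i j (TensorTriangulated.isZero_of_retract
    (ρ.map (HomologicalComplex.homologyFunctor _ (.up ℤ) (i + j))) (h₁ (i + j)))

end VectorSpaces

end BoundedDerived

/-! ### Bounded complexes of finite-dimensional vector spaces are sums of shifts of `k` -/

namespace BoundedDerived

section VectorSpaces

variable {k : Type u} [Field k]

lemma bounded_unitSingle (P : ObjectProperty (ModuleCat.{u} k)) [P.IsClosedUnderQuotients]
    [P.IsClosedUnderFiniteProducts] [P.IsMonoidal] (i : ℤ) : bounded P (unitSingle k i) := by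
  refine ⟨⟨i, ?_⟩, ⟨i, ?_⟩, fun j ↦ ?_⟩
  · rw [CochainComplex.isStrictlyGE_iff]
    exact fun j hj ↦ HomologicalComplex.isZero_single_obj_X _ _ _ _ hj.ne
  · rw [CochainComplex.isStrictlyLE_iff]
    exact fun j hj ↦ HomologicalComplex.isZero_single_obj_X _ _ _ _ hj.ne'
  · by_cases hj : j = i
    · exact P.prop_of_iso (HomologicalComplex.singleObjXIsoOfEq (.up ℤ) i _ j hj).symm P.prop_unit
    · exact prop_zero P _ (HomologicalComplex.isZero_single_obj_X _ _ _ _ hj)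

/-- The unit vector space in degree `i`, as an object of `Cᵇ(P)`. -/
noncomputable abbrev unitCb (P : ObjectProperty (ModuleCat.{u} k)) [P.IsClosedUnderQuotients]
    [P.IsClosedUnderFiniteProducts] [P.IsMonoidal] (i : ℤ) : Cb P :=
  ⟨unitSingle k i, bounded_unitSingle P i⟩

/-- The unit vector space in degree `i`, as an object of `Kᵇ(P)`. -/
noncomputable abbrev unitKb (P : ObjectProperty (ModuleCat.{u} k)) [P.IsClosedUnderQuotients]
    [P.IsClosedUnderFiniteProducts] [P.IsMonoidal] (i : ℤ) : Kb P :=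
  (quotient P).obj (unitCb P i)

lemma unitKb_hom_eq_zero (P : ObjectProperty (ModuleCat.{u} k)) [P.IsClosedUnderQuotients]
    [P.IsClosedUnderFiniteProducts] [P.IsMonoidal] {i j : ℤ} (hij : i ≠ j)
    (f : unitKb P i ⟶ unitKb P j) : f = 0 := by
  obtain ⟨f, rfl⟩ := (quotient P).map_surjective f
  have : f = 0 := by
    ext1
    exact unitSingle_hom_eq_zero hij f.hom
  rw [this, Functor.map_zero]

lemma unitKb_hom_eq_smul (P : ObjectProperty (ModuleCat.{u} k)) [P.IsClosedUnderQuotients]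
    [P.IsClosedUnderFiniteProducts] [P.IsMonoidal] {i : ℤ}
    (f : unitKb P i ⟶ unitKb P i) : ∃ c : k, f = c • 𝟙 _ := by
  obtain ⟨f, rfl⟩ := (quotient P).map_surjective f
  obtain ⟨c, hc⟩ := unitSingle_hom_eq_smul f.hom
  have : f = c • 𝟙 _ := by
    ext1
    exact hc
  exact ⟨c, by rw [this, Functor.map_smul, CategoryTheory.Functor.map_id]⟩

/-- `k[-i]` is a shift of `k`. -/
lemma nonempty_unitKb_iso_shift (P : ObjectProperty (ModuleCat.{u} k)) [P.IsClosedUnderQuotients]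
    [P.IsClosedUnderFiniteProducts] [P.IsMonoidal] (i : ℤ) :
    Nonempty (unitKb P i ≅ (unitKb P 0)⟦-i⟧) := by
  let e : (HomotopyCategory.quotient _ _).obj (unitSingle k i) ≅
      ((HomotopyCategory.quotient _ _).obj (unitSingle k 0))⟦-i⟧ :=
    (((HomotopyCategory.singleFunctors (ModuleCat.{u} k)).shiftIso (-i) i 0 (by simp)).app
      (𝟙_ (ModuleCat.{u} k))).symm
  let e' : (hBounded P).ι.obj ((unitKb P 0)⟦-i⟧) ≅ ((hBounded P).ι.obj (unitKb P 0))⟦-i⟧ :=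
    ((hBounded P).ι.commShiftIso (-i)).app (unitKb P 0)
  exact ⟨(hBounded P).ι.preimageIso (e ≪≫ e'.symm)⟩

lemma bounded_of_retract {K L : CochainComplex (ModuleCat.{u} k) ℤ} (r : Retract K L)
    (h : bounded (ModuleCat.isFG k) L) : bounded (ModuleCat.isFG k) K := by
  obtain ⟨⟨a, _⟩, ⟨b, _⟩, h⟩ := h
  have r' (n : ℤ) : Retract (K.X n) (L.X n) := r.map (HomologicalComplex.eval _ _ n)
  refine ⟨⟨a, ?_⟩, ⟨b, ?_⟩, fun n ↦ ?_⟩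
  · rw [CochainComplex.isStrictlyGE_iff]
    exact fun n hn ↦ TensorTriangulated.isZero_of_retract (r' n)
      (L.isZero_of_isStrictlyGE a n hn)
  · rw [CochainComplex.isStrictlyLE_iff]
    exact fun n hn ↦ TensorTriangulated.isZero_of_retract (r' n)
      (L.isZero_of_isStrictlyLE b n hn)
  · exact (ModuleCat.isFG k).prop_of_epi (r' n).r (h n)

lemma finrank_le_of_retract {M N : ModuleCat.{u} k} (r : Retract M N) [Module.Finite k N] :
    Module.finrank k M ≤ Module.finrank k N :=
  LinearMap.finrank_le_finrank_of_injective (f := r.i.hom)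
    ((ModuleCat.mono_iff_injective r.i).1 inferInstance)

/-- A nonzero map on `N` that vanishes on `M` shows that `M` is a proper subspace. -/
lemma finrank_lt_of_retract {M N L : ModuleCat.{u} k} (r : Retract M N) [Module.Finite k N]
    (p : N ⟶ L) (hp : p ≠ 0) (h : r.i ≫ p = 0) :
    Module.finrank k M < Module.finrank k N := by
  have hi := (ModuleCat.mono_iff_injective r.i).1 inferInstance
  have : Module.Finite k M := Module.Finite.of_injective r.i.hom hi
  refine lt_of_le_of_ne (finrank_le_of_retract r) (fun h' ↦ hp ?_)
  have := (LinearMap.injective_iff_surjective_of_finrank_eq_finrank (f := r.i.hom) h').1 hi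
  have : Epi r.i := (ModuleCat.epi_iff_surjective r.i).2 this
  rw [← cancel_epi r.i, h, comp_zero]

/-- An object is a finite direct sum of shifts of the unit. -/
def IsDecomposable (X : Kb (ModuleCat.isFG.{u} k)) : Prop :=
  ∃ (A : Type) (_ : Fintype A) (i : A → ℤ) (p : ∀ a, X ⟶ unitKb _ (i a))
    (q : ∀ a, unitKb _ (i a) ⟶ X), ∑ a, p a ≫ q a = 𝟙 X

lemma isDecomposable_of_split {X Y : Kb (ModuleCat.isFG.{u} k)} (hY : IsDecomposable Y)
    (i : ℤ) (p : X ⟶ unitKb _ i) (q : unitKb _ i ⟶ X) (f : X ⟶ Y) (g : Y ⟶ X)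
    (h : p ≫ q + f ≫ g = 𝟙 X) : IsDecomposable X := by
  obtain ⟨A, _, j, p', q', h'⟩ := hY
  refine ⟨Option A, inferInstance, fun a ↦ a.elim i j, fun a ↦ ?_, fun a ↦ ?_, ?_⟩
  · exact match a with
    | none => p
    | some a => f ≫ p' a
  · exact match a with
    | none => q
    | some a => q' a ≫ g
  · have (a : A) : (f ≫ p' a) ≫ q' a ≫ g = f ≫ (p' a ≫ q' a) ≫ g := by simp
    rw [Fintype.sum_option]
    refine Eq.trans ?_ h
    congr 1
    refine (Finset.sum_congr rfl (fun a _ ↦ this a)).trans ?_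
    rw [← Preadditive.comp_sum, ← Preadditive.sum_comp, h', Category.id_comp]

/-- A bounded above complex of projectives is K-projective, so an acyclic one is contractible; the
empty sum represents it in `Kᵇ`. -/
lemma isDecomposable_of_acyclic (K : Cb (ModuleCat.isFG.{u} k)) (hK : K.obj.Acyclic) :
    IsDecomposable ((quotient _).obj K) := by
  obtain ⟨b, _⟩ := K.property.2.1
  have (M : ModuleCat.{u} k) : Projective M :=
    ModuleCat.projective_of_free (Module.Free.chooseBasis k M)
  have := K.obj.isKProjective_of_projective b
  obtain ⟨h⟩ := CochainComplex.IsKProjective.nonempty_homotopy_zero (𝟙 K.obj) hK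
  refine ⟨PEmpty, inferInstance, PEmpty.elim, fun a ↦ a.elim, fun a ↦ a.elim, ?_⟩
  rw [Finset.univ_eq_empty, Finset.sum_empty]
  ext1
  exact ((HomotopyCategory.eq_of_homotopy _ _ h).symm.trans
    ((HomotopyCategory.quotient _ _).map_id _)).symm.trans rfl |>.symm

/-- As long as some cohomology is nonzero, a summand `k[-i]` splits off as a complex, and the
complement has smaller total dimension. -/
lemma isDecomposable (X : Kb (ModuleCat.isFG.{u} k)) : IsDecomposable X := by
  obtain ⟨K, rfl⟩ := quotient_obj_surjective _ X
  obtain ⟨K, hK⟩ := K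
  obtain ⟨a, ha⟩ := hK.1
  obtain ⟨b, hb⟩ := hK.2.1
  -- The bounds `a`, `b` stay fixed: a retract of `K` vanishes outside the same interval.
  induction hN : ∑ n ∈ Finset.Icc a b, Module.finrank k (K.X n) using Nat.strong_induction_on
    generalizing K with
  | _ N ih =>
  by_cases h : K.Acyclic
  · exact isDecomposable_of_acyclic _ h
  simp only [HomologicalComplex.Acyclic, not_forall] at h
  obtain ⟨i, hi⟩ := h
  rw [HomologicalComplex.exactAt_iff_isZero_homology] at hi
  obtain ⟨r⟩ := nonempty_retract_unitSingle K i hi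
  -- `L` is the complement of `k[-i]`, cut out by the complementary idempotent.
  obtain ⟨L, g, f, hgf, hfg⟩ := IsIdempotentComplete.idempotents_split K (𝟙 K - r.r ≫ r.i)
    (by simp)
  let ρ : Retract L K := ⟨g, f, hgf⟩
  have hL : bounded (ModuleCat.isFG k) L := bounded_of_retract ρ hK
  have ρ' (n : ℤ) : Retract (L.X n) (K.X n) := ρ.map (HomologicalComplex.eval _ _ n)
  have hgr : g ≫ r.r = 0 := by
    have : (g ≫ f ≫ g) ≫ r.r = 0 := by rw [hfg]; simp
    rwa [reassoc_of% hgf] at this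
  -- `r.r` vanishes on `L` but not on `K` in degree `i`; this makes the dimension drop there.
  have hr : r.r.f i ≠ 0 := by
    intro h
    have h' := HomologicalComplex.congr_hom r.retract i
    rw [HomologicalComplex.comp_f, h, comp_zero, HomologicalComplex.id_f] at h'
    exact not_isZero_unit (((IsZero.iff_id_eq_zero _).2 h'.symm).of_iso
      (HomologicalComplex.singleObjXSelf (.up ℤ) i (𝟙_ (ModuleCat.{u} k))).symm)
  have hFG (n : ℤ) : Module.Finite k (K.X n) := hK.2.2 n
  have hlt : ∑ n ∈ Finset.Icc a b, Module.finrank k (L.X n) < N := by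
    rw [← hN]
    refine Finset.sum_lt_sum (fun n _ ↦ finrank_le_of_retract (ρ' n)) ⟨i, ?_, ?_⟩
    · by_contra hi'
      have : IsZero (K.X i) := by
        by_cases h : i < a
        · exact K.isZero_of_isStrictlyGE a i h
        · exact K.isZero_of_isStrictlyLE b i (by rw [Finset.mem_Icc] at hi'; lia)
      exact hr (this.eq_of_src _ _)
    · exact finrank_lt_of_retract (ρ.map (HomologicalComplex.eval _ _ i)) _ hr
        (HomologicalComplex.congr_hom hgr i)
  have hL' := ih _ hlt L hL
    ((CochainComplex.isStrictlyGE_iff _ _).2 fun n hn ↦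
      TensorTriangulated.isZero_of_retract (ρ' n) (K.isZero_of_isStrictlyGE a n hn))
    ((CochainComplex.isStrictlyLE_iff _ _).2 fun n hn ↦
      TensorTriangulated.isZero_of_retract (ρ' n) (K.isZero_of_isStrictlyLE b n hn)) rfl
  refine isDecomposable_of_split hL' i ((quotient _).map (ObjectProperty.homMk r.r))
    ((quotient _).map (ObjectProperty.homMk r.i)) ((quotient _).map (ObjectProperty.homMk f))
    ((quotient _).map (ObjectProperty.homMk g)) ?_
  rw [← Functor.map_comp, ← Functor.map_comp, ← Functor.map_add, ← CategoryTheory.Functor.map_id]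
  congr 1
  ext1
  change r.r ≫ r.i + f ≫ g = 𝟙 K
  rw [hfg, add_sub_cancel]

end VectorSpaces

end BoundedDerived

/-! ### Reachable subrepresentations and representations concentrated at a vertex -/

namespace QuiverRep

variable {k : Type u} [Field k] {V : Type v} [Quiver.{w} V]

/-- The vectors at vertices which can be reached from the vertex `n`. -/
def reachableSubmodule (n : V) (M : Rep k V) (m : Paths V) : Submodule k (M.obj m) where
  -- All of `M_m` if a path leads from `n` to `m`, and zero otherwise.
  carrier := { x | Nonempty (Quiver.Path n (m : V)) ∨ x = 0 }
  zero_mem' := .inr rfl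
  add_mem' := by
    rintro x y (h | rfl) (h' | rfl)
    · exact .inl h
    · exact .inl h
    · exact .inl h'
    · exact .inr (add_zero _)
  smul_mem' := by
    rintro c x (h | rfl)
    · exact .inl h
    · exact .inr (smul_zero _)

lemma map_mem_reachableSubmodule (n : V) (M : Rep k V) {a b : Paths V} (p : a ⟶ b)
    {x : M.obj a} (hx : x ∈ reachableSubmodule n M a) :
    (M.map p).hom x ∈ reachableSubmodule n M b := by
  rcases hx with ⟨⟨q⟩⟩ | rfl
  · exact .inl ⟨Quiver.Path.comp q p⟩
  · exact .inr (map_zero _)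

lemma app_mem_reachableSubmodule (n : V) {M N : Rep k V} (f : M ⟶ N) {a : Paths V}
    {x : M.obj a} (hx : x ∈ reachableSubmodule n M a) :
    (f.app a).hom x ∈ reachableSubmodule n N a := by
  rcases hx with h | rfl
  · exact .inl h
  · exact .inr (map_zero _)

/-- The subrepresentation supported on the vertices which can be reached from `n`. -/
def reachable (n : V) : Rep k V ⥤ Rep k V where
  obj M :=
    { obj m := ModuleCat.of k (reachableSubmodule n M m)
      map p := ModuleCat.ofHom
        ((M.map p).hom.restrict (fun _ hx ↦ map_mem_reachableSubmodule n M p hx))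
      map_id m := ModuleCat.hom_ext (LinearMap.ext fun x ↦ Subtype.ext
        (congr($(M.map_id m) x.1)))
      map_comp p q := ModuleCat.hom_ext (LinearMap.ext fun x ↦ Subtype.ext
        (congr($(M.map_comp p q) x.1))) }
  map f :=
    { app m := ModuleCat.ofHom
        ((f.app m).hom.restrict (fun _ hx ↦ app_mem_reachableSubmodule n f hx))
      naturality a b p := ModuleCat.hom_ext (LinearMap.ext fun x ↦ Subtype.ext
        (NatTrans.naturality_apply f p x.1)) }

instance (n : V) : (reachable (k := k) n).Additive where

/-- The inclusion of the subrepresentation supported on the vertices reached from `n`. -/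
def reachableι (n : V) : reachable (k := k) n ⟶ 𝟭 (Rep k V) where
  app M := { app m := ModuleCat.ofHom (reachableSubmodule n M m).subtype }

instance (n : V) (M : Rep k V) : IsIso ((vertex n).map ((reachableι n).app M)) := by
  rw [ConcreteCategory.isIso_iff_bijective]
  exact ⟨Subtype.val_injective, fun x ↦ ⟨⟨x, .inl ⟨.nil⟩⟩, rfl⟩⟩

/-- Relations and finite dimension pass to subrepresentations. -/
lemma finRep_le_reachable (R : Relations k V) (n : V) :
    finRep R ≤ (finRep R).inverseImage (reachable n) := by
  intro M hM
  refine ⟨fun m ↦ ?_, fun a b r hr ↦ ?_⟩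
  · have : Module.Finite k (M.obj m) := hM.1 m
    exact inferInstanceAs (Module.Finite k (reachableSubmodule n M m))
  · have : Mono ((vertex b).map ((reachableι n).app M)) :=
      (ModuleCat.mono_iff_injective _).2 Subtype.val_injective
    rw [← cancel_mono ((vertex b).map ((reachableι n).app M)), act_naturality]
    erw [hM.2 a b r hr]
    rw [comp_zero, zero_comp]

section Skyscraper

variable (hV : ∀ (a : V) (p : Quiver.Path a a), p.length = 0)
include hV

lemma eq_of_path_of_path {a b : V} (p : Quiver.Path a b) (q : Quiver.Path b a) : a = b := by
  have h := hV a (p.comp q)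
  rw [Quiver.Path.length_comp] at h
  exact Quiver.Path.eq_of_length_zero p (by lia)

open Classical in
/-- The representation with `W` at the vertex `n` and zero elsewhere. -/
noncomputable def skyscraper (n : V) : ModuleCat.{u} k ⥤ Rep k V where
  obj W :=
    -- Functions on the proofs of `m = n`: a copy of `W` at `n` and zero elsewhere, without casts
    -- along equalities of vertices.
    { obj m := ModuleCat.of k (PLift ((m : V) = n) → W)
      map {a b} p := ModuleCat.ofHom
        { toFun x _ := if h : (a : V) = n then x ⟨h⟩ else 0
          map_add' x y := by
            funext _
            by_cases h : (a : V) = n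
            · simp only [dif_pos h, Pi.add_apply]
            · simp only [dif_neg h, Pi.add_apply, add_zero]
          map_smul' c x := by
            funext _
            by_cases h : (a : V) = n
            · simp only [dif_pos h, Pi.smul_apply, RingHom.id_apply]
            · simp only [dif_neg h, Pi.smul_apply, smul_zero] }
      map_id m := ModuleCat.hom_ext (LinearMap.ext fun x ↦ funext fun h ↦ dif_pos h.down)
      map_comp {a b c} p q := ModuleCat.hom_ext (LinearMap.ext fun x ↦ funext fun h ↦ by
        obtain ⟨h⟩ := h
        change (if h : (a : V) = n then x ⟨h⟩ else 0) =
          (if (b : V) = n then (if h : (a : V) = n then x ⟨h⟩ else 0) else 0)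
        by_cases hb : (b : V) = n
        · rw [if_pos hb]
        · rw [if_neg hb, dif_neg]
          -- Functoriality could only fail for a path that leaves `n` and returns to it through `b ≠
          -- n`; acyclicity excludes this.
          intro ha
          subst ha
          subst h
          exact hb (eq_of_path_of_path hV q p)) }
  map {W W'} f :=
    { app m := ModuleCat.ofHom (f.hom.compLeft _)
      naturality a b p := ModuleCat.hom_ext (LinearMap.ext fun x ↦ funext fun h ↦ by
        change f.hom (if h : (a : V) = n then x ⟨h⟩ else 0) =
          (if h : (a : V) = n then f.hom (x ⟨h⟩) else 0)
        by_cases ha : (a : V) = n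
        · rw [dif_pos ha, dif_pos ha]
        · rw [dif_neg ha, dif_neg ha, map_zero]) }

instance (n : V) : (skyscraper (k := k) hV n).Additive where

instance (n : V) : (skyscraper (k := k) hV n).Linear k where

lemma isZero_vertex_skyscraper {m n : V} (hmn : m ≠ n) (W : ModuleCat.{u} k) :
    IsZero ((vertex m).obj ((skyscraper hV n).obj W)) := by
  have : Subsingleton ((vertex m).obj ((skyscraper hV n).obj W)) :=
    ⟨fun x y ↦ funext fun h ↦ (hmn h.down).elim⟩
  exact ModuleCat.isZero_of_subsingleton _

/-- This is where the relations must involve nontrivial paths only: such a path is not a loop at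
`n`, so it acts by zero and every relation holds. -/
lemma isFG_le_skyscraper (R : Relations k V) [R.IsTensor] (n : V) :
    ModuleCat.isFG.{u} k ≤ (finRep R).inverseImage (skyscraper hV n) := by
  intro W (hW : Module.Finite k W)
  refine ⟨fun m ↦ inferInstanceAs (Module.Finite k (PLift (m = n) → W)), fun a b r hr ↦ ?_⟩
  refine Finset.sum_eq_zero (fun p hp ↦ ?_)
  convert smul_zero (r p)
  have hp := Relations.IsTensor.length_pos a b r hr p hp
  refine ModuleCat.hom_ext (LinearMap.ext fun x ↦ funext fun h ↦ dif_neg fun ha ↦ ?_)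
  obtain ⟨h⟩ := h
  change b = n at h
  change a = n at ha
  subst ha
  subst h
  exact hp.ne' (hV _ p)

/-- The projection from the subrepresentation supported on the vertices reached from `n` to
the vector space at `n`. -/
noncomputable def reachableπ (n : V) :
    reachable (k := k) n ⟶ vertex n ⋙ skyscraper hV n where
  app M :=
    { app m := ModuleCat.ofHom
        (LinearMap.pi fun h : PLift ((m : V) = n) ↦
          (M.map (eqToHom (C := Paths V) h.down)).hom ∘ₗ (reachableSubmodule n M m).subtype)
      naturality a b p := ModuleCat.hom_ext (LinearMap.ext fun x ↦ funext fun h ↦ by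
        obtain ⟨x, hx⟩ := x
        obtain ⟨h⟩ := h
        change V at a b
        change Quiver.Path a b at p
        change b = n at h
        subst h
        refine (congr($(M.map_id ((Paths.of V).obj b)) (M.map (X := (Paths.of V).obj a) p x))).trans
          (Eq.symm ?_)
        by_cases ha : a = b
        · refine (dif_pos ha).trans ?_
          subst ha
          rw [Quiver.Path.eq_nil_of_length_zero p (hV _ p)]
          rfl
        · refine (dif_neg ha).trans ?_
          -- The target `b` of `p` is now the base vertex. A vector at `a ≠ b` in the reachable part
          -- must be zero, since a path from `b` to `a` would form a cycle with `p`. On all of `M`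
          -- the projection would not be a morphism.
          rcases hx with ⟨⟨q⟩⟩ | rfl
          · exact (ha (eq_of_path_of_path hV p q)).elim
          · exact (map_zero
              (M.map (X := (Paths.of V).obj a) (Y := (Paths.of V).obj b) p).hom).symm) }
  naturality M N f := by
    refine NatTrans.ext (funext fun m ↦ ModuleCat.hom_ext (LinearMap.ext fun x ↦ ?_))
    refine funext fun (h : PLift ((m : V) = n)) ↦ ?_
    exact (NatTrans.naturality_apply f (eqToHom (C := Paths V) h.down) x.1).symm

instance (n : V) (M : Rep k V) : IsIso ((vertex n).map ((reachableπ hV n).app M)) := by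
  rw [ConcreteCategory.isIso_iff_bijective]
  have key (x : reachableSubmodule n M n) (h : PLift (n = n)) :
      (((vertex n).map ((reachableπ hV n).app M)).hom x : PLift (n = n) → (vertex n).obj M) h =
        x.1 :=
    congr($(M.map_id ((Paths.of V).obj n)) x.1)
  exact ⟨fun x y h ↦ Subtype.ext (((key x ⟨rfl⟩).symm.trans (congr_fun h ⟨rfl⟩)).trans
    (key y ⟨rfl⟩)), fun x ↦ ⟨⟨x ⟨rfl⟩, .inl ⟨.nil⟩⟩, funext fun h ↦ key _ h⟩⟩

end Skyscraper

end QuiverRep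

/-! ### Natural transformations on homotopy categories -/

namespace BoundedDerived

section Functoriality

variable {A : Type*} [Category* A] [Abelian A] {P : ObjectProperty A}
  [P.IsClosedUnderQuotients] [P.IsClosedUnderFiniteProducts]
  {A' : Type*} [Category* A'] [Abelian A'] (P' : ObjectProperty A')
  [P'.IsClosedUnderQuotients] [P'.IsClosedUnderFiniteProducts]
  {A'' : Type*} [Category* A''] [Abelian A''] (P'' : ObjectProperty A'')
  [P''.IsClosedUnderQuotients] [P''.IsClosedUnderFiniteProducts]

/-- The natural transformation induced by a natural transformation of additive functors. -/
noncomputable def mapKbTrans {F G : A ⥤ A'} [F.Additive] [G.Additive] (τ : F ⟶ G)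
    (hF : P ≤ P'.inverseImage F) (hG : P ≤ P'.inverseImage G) :
    mapKb P' F hF ⟶ mapKb P' G hG where
  app K := ObjectProperty.homMk ((NatTrans.mapHomotopyCategory τ (.up ℤ)).app K.obj)
  naturality K L f := by
    ext
    exact (NatTrans.mapHomotopyCategory τ (.up ℤ)).naturality f.hom

variable (P) in
/-- The identity functor induces the identity functor. -/
noncomputable def mapKbId : mapKb (P := P) P (𝟭 A) (fun _ h ↦ h) ≅ 𝟭 (Kb P) :=
  NatIso.ofComponents (fun _ ↦ Iso.refl _) (fun {K L} f ↦ by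
    obtain ⟨K, rfl⟩ := quotient_obj_surjective P K
    obtain ⟨L, rfl⟩ := quotient_obj_surjective P L
    obtain ⟨f, rfl⟩ := (quotient P).map_surjective f
    refine (Category.comp_id _).trans (Eq.trans ?_ (Category.id_comp _).symm)
    ext
    exact (𝟭 A).mapHomotopyCategory_map f.hom)

/-- The functor induced by a composition. -/
noncomputable def mapKbComp (F : A ⥤ A') [F.Additive] (G : A' ⥤ A'') [G.Additive]
    (hF : P ≤ P'.inverseImage F) (hG : P' ≤ P''.inverseImage G)
    (hFG : P ≤ P''.inverseImage (F ⋙ G)) :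
    mapKb P' F hF ⋙ mapKb P'' G hG ≅ mapKb P'' (F ⋙ G) hFG :=
  NatIso.ofComponents (fun _ ↦ Iso.refl _) (fun {K L} f ↦ by
    obtain ⟨K, rfl⟩ := quotient_obj_surjective P K
    obtain ⟨L, rfl⟩ := quotient_obj_surjective P L
    obtain ⟨f, rfl⟩ := (quotient P).map_surjective f
    refine (Category.comp_id _).trans (Eq.trans ?_ (Category.id_comp _).symm)
    ext
    exact (congr_arg (G.mapHomotopyCategory (.up ℤ)).map (F.mapHomotopyCategory_map f.hom)).trans
      ((G.mapHomotopyCategory_map _).trans ((F ⋙ G).mapHomotopyCategory_map f.hom).symm))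

/-- Applying `H` to `τ` gives an isomorphism in each degree, hence one of complexes, already before
localization. With `H` the functor at a vertex, this applies to both legs of the roof. -/
lemma isIso_mapDb_map_mapKbTrans {F G : A ⥤ A'} [F.Additive] [G.Additive] (τ : F ⟶ G)
    (hF : P ≤ P'.inverseImage F) (hG : P ≤ P'.inverseImage G)
    (H : A' ⥤ A'') [H.Additive] [PreservesFiniteLimits H] [PreservesFiniteColimits H]
    (hH : P' ≤ P''.inverseImage H) (hτ : ∀ X, IsIso (H.map (τ.app X))) (K : Kb P) :
    IsIso ((mapDb P'' H hH).map ((Qh P').map ((mapKbTrans P' τ hF hG).app K))) := by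
  have : IsIso ((H.mapHomologicalComplex (.up ℤ)).map
      ((NatTrans.mapHomologicalComplex τ (.up ℤ)).app K.obj.as)) := by
    have (i : ℤ) : IsIso (((H.mapHomologicalComplex (.up ℤ)).map
        ((NatTrans.mapHomologicalComplex τ (.up ℤ)).app K.obj.as)).f i) := hτ _
    exact HomologicalComplex.Hom.isIso_of_components _
  have : IsIso ((mapKb P'' H hH).map ((mapKbTrans P' τ hF hG).app K)) := by
    have : IsIso ((hBounded P'').ι.map
        ((mapKb P'' H hH).map ((mapKbTrans P' τ hF hG).app K))) := by
      have e := H.mapHomotopyCategory_map (c := .up ℤ)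
        ((NatTrans.mapHomologicalComplex τ (.up ℤ)).app K.obj.as)
      change IsIso ((H.mapHomotopyCategory (.up ℤ)).map ((HomotopyCategory.quotient _ _).map _))
      rw [e]
      exact Functor.map_isIso _ _
    exact isIso_of_reflects_iso _ (hBounded P'').ι
  exact (NatIso.isIso_map_iff (mapDbFactors P'' H hH) _).2
    (inferInstanceAs (IsIso ((Qh P'').map _)))

end Functoriality

end BoundedDerived

/-! ### The roof at a vertex and the classification of primes -/

namespace QuiverRep

open TensorTriangulated

variable {k : Type u} [Field k] {V : Type v} [Quiver.{w} V] (R : Relations k V) [R.IsTensor]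

/-- Cohomology commutes with evaluation at a vertex, and a representation that vanishes at every
vertex is zero. -/
lemma isZero_of_isZero_vertexFunctor (Vect : ObjectProperty (ModuleCat.{u} k))
    [Vect.IsClosedUnderQuotients] [Vect.IsClosedUnderFiniteProducts] [Vect.IsMonoidal]
    (X : D R) (h : ∀ n, functorKernel (vertexFunctor R Vect n) X) : IsZero X := by
  have hX (i : ℤ) : IsZero ((cohomology (finRep R) i).obj X) := by
    rw [Functor.isZero_iff]
    intro n
    exact (isZero_cohomology (h n) i).of_iso
      ((mapDbCohomology (P := finRep R) Vect (vertex (k := k) (V := V) n)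
        (finRep_le R Vect n) i).app X).symm
  let e := (Q (finRep R)).objObjPreimageIso X
  refine IsZero.of_iso ?_ e.symm
  rw [isZero_Q_iff]
  intro i
  exact (hX i).of_iso (((QCohomology (finRep R) i).app _).symm ≪≫
    (cohomology (finRep R) i).mapIso e)

/-- The functor `Kᵇ` of the functor taking the vector space at a vertex. -/
noncomputable abbrev vertexKb (n : V) : Kb (finRep R) ⥤ Kb (ModuleCat.isFG.{u} k) :=
  mapKb (ModuleCat.isFG k) (vertex n) (fun _ hM ↦ hM.1 n)

variable (hV : ∀ (a : V) (p : Quiver.Path a a), p.length = 0)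

/-- The functor `Kᵇ` of the functor sending a vector space to the representation concentrated at
a vertex. -/
noncomputable abbrev skyscraperKb (n : V) : Kb (ModuleCat.isFG.{u} k) ⥤ Kb (finRep R) :=
  mapKb (finRep R) (skyscraper hV n) (isFG_le_skyscraper hV R n)

/-- The subcomplex supported on the vertices reached from `n`, as a functor. -/
noncomputable abbrev reachableKb (n : V) : Kb (finRep R) ⥤ Kb (finRep R) :=
  mapKb (finRep R) (reachable n) (finRep_le_reachable R n)

/-- The inclusion of the subcomplex supported on the vertices reached from `n`. -/
noncomputable def reachableKbι (n : V) : reachableKb R n ⟶ 𝟭 _ :=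
  mapKbTrans (finRep R) (reachableι n) (finRep_le_reachable R n) le_rfl ≫ (mapKbId (finRep R)).hom

lemma finRep_le_vertex_comp_skyscraper (n : V) :
    finRep R ≤ (finRep R).inverseImage (vertex n ⋙ skyscraper hV n) :=
  fun _ hM ↦ isFG_le_skyscraper hV R n _ (hM.1 n)

/-- The projection from the subcomplex supported on the vertices reached from `n` to
the complex at `n`. -/
noncomputable def reachableKbπ (n : V) :
    reachableKb R n ⟶ vertexKb R n ⋙ skyscraperKb R hV n :=
  mapKbTrans (finRep R) (reachableπ hV n) (finRep_le_reachable R n)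
      (finRep_le_vertex_comp_skyscraper R hV n) ≫
    (mapKbComp (ModuleCat.isFG k) (finRep R) (vertex n) (skyscraper hV n) _ _ _).inv

section

variable (Vect : ObjectProperty (ModuleCat.{u} k))
  [Vect.IsClosedUnderQuotients] [Vect.IsClosedUnderFiniteProducts] [Vect.IsMonoidal]

instance (n : V) (K : Kb (finRep R)) : IsIso ((vertexFunctor R Vect n).map
    ((Qh _).map ((reachableKbι R n).app K))) := by
  have := isIso_mapDb_map_mapKbTrans (finRep R) Vect (reachableι n)
    (finRep_le_reachable R n) le_rfl (vertex n) (finRep_le R Vect n) inferInstance K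
  dsimp only [reachableKbι, NatTrans.comp_app]
  rw [Functor.map_comp, Functor.map_comp]
  exact IsIso.comp_isIso' this inferInstance

instance (n : V) (K : Kb (finRep R)) : IsIso ((vertexFunctor R Vect n).map
    ((Qh _).map ((reachableKbπ R hV n).app K))) := by
  have := isIso_mapDb_map_mapKbTrans (finRep R) Vect (reachableπ hV n)
    (finRep_le_reachable R n) (finRep_le_vertex_comp_skyscraper R hV n)
    (vertex n) (finRep_le R Vect n) inferInstance K
  dsimp only [reachableKbπ, NatTrans.comp_app]
  rw [Functor.map_comp, Functor.map_comp]
  exact IsIso.comp_isIso' this inferInstance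

end

/-- The shifted one-dimensional representation at the vertex `n`. -/
noncomputable abbrev simple (n : V) (i : ℤ) : D R :=
  (Qh (finRep R)).obj ((skyscraperKb R hV n).obj (unitKb (ModuleCat.isFG k) i))

lemma nonempty_simple_iso_shift (n : V) (i : ℤ) :
    Nonempty (simple R hV n i ≅ (simple R hV n 0)⟦-i⟧) := by
  obtain ⟨e⟩ := nonempty_unitKb_iso_shift (ModuleCat.isFG.{u} k) i
  exact ⟨(skyscraperKb R hV n ⋙ Qh (finRep R)).mapIso e ≪≫
    ((skyscraperKb R hV n ⋙ Qh (finRep R)).commShiftIso (-i)).app _⟩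

lemma nonempty_vertexKb_unit_iso (n : V) :
    Nonempty ((vertexKb R n).obj ((quotient _).obj (𝟙_ (Cb (finRep R)))) ≅
      unitKb (ModuleCat.isFG k) 0) := by
  let e : (mapCb (ModuleCat.isFG k) (vertex n) (fun _ hM ↦ hM.1 n)).obj (𝟙_ (Cb (finRep R))) ≅
      unitCb (ModuleCat.isFG k) 0 :=
    (bounded _).ι.preimageIso
      ((HomologicalComplex.singleMapHomologicalComplex (vertex n) (.up ℤ) 0).app (𝟙_ (Rep k V)))
  exact ⟨(mapKbFactors (ModuleCat.isFG k) (vertex n) (fun _ hM ↦ hM.1 n)).app _ ≪≫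
    (quotient _).mapIso e⟩

/-- The complex `K_n` has nonzero cohomology in some degree `i`, so `k[-i]` is a retract of it, and
functors preserve retracts. -/
lemma nonempty_retract_simple (n : V) (Vect : ObjectProperty (ModuleCat.{u} k))
    [Vect.IsClosedUnderQuotients] [Vect.IsClosedUnderFiniteProducts] [Vect.IsMonoidal]
    (K : Kb (finRep R)) (hK : ¬ functorKernel (vertexFunctor R Vect n) ((Qh _).obj K)) :
    ∃ i, Nonempty (Retract (simple R hV n i)
      ((Qh _).obj ((skyscraperKb R hV n).obj ((vertexKb R n).obj K)))) := by
  obtain ⟨K, rfl⟩ := quotient_obj_surjective _ K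
  let L := (mapCb (ModuleCat.isFG k) (vertex n) (fun _ hM ↦ hM.1 n)).obj K
  obtain ⟨i, hi⟩ : ∃ i, ¬ IsZero (L.obj.homology i) := by
    by_contra! h
    refine hK (IsZero.of_iso ?_ ((QMapDb Vect (vertex n) (finRep_le R Vect n)).app K))
    -- The complex at `n` is the same whether its terms are viewed in `ModuleCat.isFG k` or in
    -- `Vect`, so its acyclicity does not depend on this choice.
    exact (isZero_Q_iff _).2 h
  obtain ⟨r⟩ := nonempty_retract_unitSingle L.obj i hi
  let r' : Retract (unitCb (ModuleCat.isFG k) i) L :=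
    ⟨ObjectProperty.homMk r.i, ObjectProperty.homMk r.r, by ext1; exact r.retract⟩
  exact ⟨i, ⟨r'.map (quotient _ ⋙ skyscraperKb R hV n ⋙ Qh _)⟩⟩

lemma kernel_vertexFunctor_simple {m n : V} (hmn : m ≠ n)
    (Vect : ObjectProperty (ModuleCat.{u} k))
    [Vect.IsClosedUnderQuotients] [Vect.IsClosedUnderFiniteProducts] [Vect.IsMonoidal] (i : ℤ) :
    functorKernel (vertexFunctor R Vect m) (simple R hV n i) := by
  let L := (mapCb (finRep R) (skyscraper hV n) (isFG_le_skyscraper hV R n)).obj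
    (unitCb (ModuleCat.isFG k) i)
  refine IsZero.of_iso ((isZero_Q_iff _).2 fun j ↦ ?_)
    ((QMapDb Vect (vertex m) (finRep_le R Vect m)).app L)
  rw [← HomologicalComplex.exactAt_iff_isZero_homology]
  exact ShortComplex.exact_of_isZero_X₂ _ (isZero_vertex_skyscraper hV hmn _)

section

variable {Vect : ObjectProperty (ModuleCat.{u} k)}
  [Vect.IsClosedUnderQuotients] [Vect.IsClosedUnderFiniteProducts] [Vect.IsMonoidal]

section

variable {F : D R ⥤ Db Vect} (hF : IsTTFunctor k F) {n : V}
  (h : functorKernel (vertexFunctor R Vect n) ≤ functorKernel F)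

include hF h

/-- A tensor functor whose kernel contains the kernel of the functor at a vertex `n` only
depends on the complex at `n`. -/
lemma nonempty_Qh_comp_iso :
    Nonempty (Qh _ ⋙ F ≅ vertexKb R n ⋙ skyscraperKb R hV n ⋙ Qh _ ⋙ F) := by
  have hn := isTTFunctor_vertexFunctor R Vect n
  -- Both legs of the roof are inverted by the functor at `n`, hence by `F`, whose kernel is at
  -- least as large.
  have h₁ (K) : IsIso ((Functor.whiskerRight (reachableKbι R n) (Qh _ ⋙ F)).app K) :=
    hn.isIso_of_kernel_le hF h ((Qh _).map ((reachableKbι R n).app K))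
  have h₂ (K) : IsIso ((Functor.whiskerRight (reachableKbπ R hV n) (Qh _ ⋙ F)).app K) :=
    hn.isIso_of_kernel_le hF h ((Qh _).map ((reachableKbπ R hV n).app K))
  have := NatIso.isIso_of_isIso_app (Functor.whiskerRight (reachableKbι R n) (Qh _ ⋙ F))
  have := NatIso.isIso_of_isIso_app (Functor.whiskerRight (reachableKbπ R hV n) (Qh _ ⋙ F))
  exact ⟨(asIso (Functor.whiskerRight (reachableKbι R n) (Qh _ ⋙ F))).symm ≪≫
    asIso (Functor.whiskerRight (reachableKbπ R hV n) (Qh _ ⋙ F))⟩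

/-- The roof of the unit representation ends in the one-dimensional representation at `n`, so `F`
sends the latter to `F(𝟙) ≅ 𝟙`. -/
lemma nonempty_obj_simple_iso : Nonempty (F.obj (simple R hV n 0) ≅ 𝟙_ (Db Vect)) := by
  obtain ⟨e⟩ := nonempty_Qh_comp_iso R hV hF h
  obtain ⟨e'⟩ := nonempty_vertexKb_unit_iso R n
  obtain ⟨_⟩ := hF.monoidal
  exact ⟨(skyscraperKb R hV n ⋙ Qh _ ⋙ F).mapIso e'.symm ≪≫ (e.app _).symm ≪≫
    F.mapIso (Functor.Monoidal.εIso (Q (finRep R))).symm ≪≫ (Functor.Monoidal.εIso F).symm⟩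

end

include hV in
-- The one-dimensional representation at `n` is killed at every other vertex, but sent to the
-- nonzero unit at `n`.
lemma kernel_vertexFunctor_injective :
    Function.Injective (fun n : V ↦ functorKernel (vertexFunctor R Vect n)) := by
  intro m n (h : functorKernel _ = functorKernel _)
  by_contra hmn
  have h₀ := kernel_vertexFunctor_simple R hV hmn Vect 0
  rw [h] at h₀
  obtain ⟨e⟩ := nonempty_obj_simple_iso R hV (isTTFunctor_vertexFunctor R Vect n)
    (le_refl (functorKernel (vertexFunctor R Vect n)))
  exact not_isZero_unit_Db Vect (h₀.of_iso e.symm)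

variable {P : ObjectProperty (D R)} (hP : IsPrime P) {n : V}
  (h : functorKernel (vertexFunctor R Vect n) ≤ P)

include hP h

lemma prop_Qh_obj_iff (K : Kb (finRep R)) :
    P ((Qh _).obj K) ↔ P ((Qh _).obj ((skyscraperKb R hV n).obj ((vertexKb R n).obj K))) := by
  have hn := isTTFunctor_vertexFunctor R Vect n
  exact (hP.mem_iff_of_isIso hn h ((Qh _).map ((reachableKbι R n).app K))).symm.trans
    (hP.mem_iff_of_isIso hn h ((Qh _).map ((reachableKbπ R hV n).app K)))

include hV in
-- An object of `P` not killed at `n` would put a shift of the one-dimensional representation at `n`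
-- into `P`, hence this representation itself, hence the unit.
lemma eq_kernel_of_kernel_le : P = functorKernel (vertexFunctor R Vect n) := by
  have := hP.isTriangulated
  have := hP.isStableUnderRetracts
  refine le_antisymm (fun X hX ↦ ?_) h
  by_contra hX'
  let e := (Qh (finRep R)).objObjPreimageIso X
  rw [← P.prop_iff_of_iso e, prop_Qh_obj_iff R hV hP h] at hX
  obtain ⟨i, ⟨r⟩⟩ := nonempty_retract_simple R hV n Vect ((Qh (finRep R)).objPreimage X)
    (fun h' ↦ hX' (h'.of_iso ((vertexFunctor R Vect n).mapIso e.symm)))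
  have hi := P.prop_of_retract r hX
  obtain ⟨e'⟩ := nonempty_simple_iso_shift R hV n i
  rw [P.prop_iff_of_iso e', P.prop_shift_iff_of_isStableUnderShift] at hi
  obtain ⟨e''⟩ := nonempty_vertexKb_unit_iso R n
  -- The roof is now used backwards, for the unit complex.
  refine hP.not_mem_unit (P.prop_of_iso (Functor.Monoidal.εIso (Q (finRep R))).symm ?_)
  refine (prop_Qh_obj_iff R hV hP h _).2 (P.prop_of_iso ?_ hi)
  exact (skyscraperKb R hV n ⋙ Qh _).mapIso e''.symm

end

end QuiverRep

/-! ### Classification of points -/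

namespace QuiverRep

variable {k : Type u} [Field k] {V : Type v} [Quiver.{w} V] (R : Relations k V) [R.IsTensor]
  (hV : ∀ (a : V) (p : Quiver.Path a a), p.length = 0)
  {Vect : ObjectProperty (ModuleCat.{u} k)}
  [Vect.IsClosedUnderQuotients] [Vect.IsClosedUnderFiniteProducts] [Vect.IsMonoidal]

lemma nonempty_obj_simple_iso_shift {F : D R ⥤ Db Vect} (hF : IsTTFunctor k F) {n : V}
    (h : functorKernel (vertexFunctor R Vect n) ≤ functorKernel F) (i : ℤ) :
    Nonempty (F.obj (simple R hV n i) ≅ (𝟙_ (Db Vect))⟦-i⟧) := by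
  obtain ⟨_, _⟩ := hF.exact
  obtain ⟨e⟩ := nonempty_simple_iso_shift R hV n i
  obtain ⟨e'⟩ := nonempty_obj_simple_iso R hV hF h
  exact ⟨F.mapIso e ≪≫ (F.commShiftIso (-i)).app _ ≪≫ (shiftFunctor _ (-i)).mapIso e'⟩

include hV in
-- By the roof, both functors are determined by their restrictions to complexes of
-- finite-dimensional vector spaces, placed at `n`. These linear functors agree on every `k[-i]`,
-- hence on all sums.
lemma nonempty_iso_vertexFunctor {F : D R ⥤ Db Vect} (hF : IsTTFunctor k F) {n : V}
    (h : functorKernel (vertexFunctor R Vect n) ≤ functorKernel F) :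
    Nonempty (F ≅ vertexFunctor R Vect n) := by
  have hn := isTTFunctor_vertexFunctor R Vect n
  have := hF.additive
  have := hF.linear
  have := hn.additive
  have := hn.linear
  obtain ⟨e⟩ := nonempty_iso_of_decomposition (k := k) (skyscraperKb R hV n ⋙ Qh _ ⋙ F)
    (skyscraperKb R hV n ⋙ Qh _ ⋙ vertexFunctor R Vect n) (unitKb (ModuleCat.isFG.{u} k))
    (fun _ _ f hij ↦ unitKb_hom_eq_zero _ hij f) (fun _ f ↦ unitKb_hom_eq_smul _ f)
    isDecomposable (fun i ↦ (nonempty_obj_simple_iso_shift R hV hF h i).some ≪≫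
      (nonempty_obj_simple_iso_shift R hV hn le_rfl i).some.symm)
  obtain ⟨e₁⟩ := nonempty_Qh_comp_iso R hV hF h
  obtain ⟨e₂⟩ := nonempty_Qh_comp_iso R hV hn le_rfl
  exact ⟨Localization.liftNatIso (Qh (finRep R)) (hQuasiIso (finRep R)) _ _ _ _
    (e₁ ≪≫ Functor.isoWhiskerLeft (vertexKb R n) e ≪≫ e₂.symm)⟩

end QuiverRep

theorem mainTheorem3 {k : Type u} [Field k] {V : Type v} [Quiver.{w} V]
    [Finite V] [∀ a b : V, Finite (a ⟶ b)]
    (hV : ∀ (a : V) (p : Quiver.Path a a), p.length = 0)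
    (R : Relations k V) [R.IsTensor]
    (Vect : ObjectProperty (ModuleCat.{u} k)) [Vect.IsClosedUnderQuotients]
    [Vect.IsClosedUnderFiniteProducts] [Vect.IsMonoidal] :
    (∀ (n : V) (i : ℤ), Nonempty (vertexFunctor R Vect n ⋙ cohomology Vect i ≅
      cohomology (finRep R) i ⋙ vertex n)) ∧
    ∃ (hF : ∀ n : V, IsTTFunctor k (vertexFunctor R Vect n))
      (hker : ∀ x : Points k (D R) (Db Vect), IsPrime x.ker),
      Function.Bijective (fun n : V ↦ Points.mk k (vertexFunctor R Vect n) (hF n)) ∧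
      Function.Bijective (fun x : Points k (D R) (Db Vect) ↦ (⟨x.ker, hker x⟩ : Spc (D R))) := by
  have hF (n : V) := isTTFunctor_vertexFunctor R Vect n
  have hS := isZero_tensor_Db_iff Vect
  have hker (x : Points k (D R) (Db Vect)) : IsPrime x.ker := by
    obtain ⟨⟨F, hF⟩, rfl⟩ := Quotient.exists_rep x
    exact hF.isPrime_kernel hS (not_isZero_unit_Db Vect)
  -- Every prime contains the kernel at some vertex and is therefore equal to it.
  have hprime {P : ObjectProperty (D R)} (hP : IsPrime P) :
      ∃ n, P = functorKernel (vertexFunctor R Vect n) := by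
    obtain ⟨n, hn⟩ := hP.exists_kernel_le _ hF hS (isZero_of_isZero_vertexFunctor R Vect)
    exact ⟨n, eq_kernel_of_kernel_le R hV hP hn⟩
  have hsurj : Function.Surjective
      (fun n : V ↦ Points.mk k (vertexFunctor R Vect n) (hF n)) := fun x ↦ by
    obtain ⟨n, hn⟩ := hprime (hker x)
    obtain ⟨⟨F, hF'⟩, rfl⟩ := Quotient.exists_rep x
    -- The kernel of a point is prime, so it is the kernel at some vertex `n`, and it determines the
    -- point.
    obtain ⟨e⟩ := nonempty_iso_vertexFunctor R hV hF' (n := n) hn.ge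
    exact ⟨n, (Points.mk_eq_iff (hF n) hF').2 ⟨e.symm⟩⟩
  refine ⟨fun n i ↦ ⟨mapDbCohomology Vect (vertex n) (finRep_le R Vect n) i⟩, hF, hker,
    ⟨fun m n h ↦ ?_, hsurj⟩, fun x y h ↦ ?_, fun ⟨P, hP⟩ ↦ ?_⟩
  · exact kernel_vertexFunctor_injective (Vect := Vect) R hV
      (congr_arg (fun x : Points k (D R) (Db Vect) ↦ x.ker) h)
  · obtain ⟨m, rfl⟩ := hsurj x
    obtain ⟨n, rfl⟩ := hsurj y
    have hmn : m = n :=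
      kernel_vertexFunctor_injective (Vect := Vect) R hV (congr_arg Subtype.val h)
    rw [hmn]
  · obtain ⟨n, rfl⟩ := hprime hP
    exact ⟨Points.mk k (vertexFunctor R Vect n) (hF n), rfl⟩
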